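/- An \emph{ample groupoid} $\mathcal G$ is a topological groupoid (not necessarily Hausdorff, viewed as its set of arrows, with objects identified with identity arrows) whose domain map onto the unit space $\mathcal G^0$ is a local homeomorphism and whose unit space is locally compact, Hausdorff and has a basis of compact open sets. A \emph{compact local bisection} is a compact open set $U\subseteq\mathcal G$ on which the domain and range maps are homeomorphisms onto their images. For a field $K$, the \emph{Steinberg algebra} $K\mathcal G$ is the $K$-span, inside the space of functions $\mathcal G\to K$, of the characteristic functions of compact local bisections, with the convolution product $(f*g)(\gamma)=\sum_{\alpha\beta=\gamma}f(\alpha)g(\beta)$. An \emph{inverse semigroup} is a semigroup $S$ in which every $s$ has a unique $t$ with $sts=s$ and $tst=t$; if $S$ has a zero, its \emph{contracted semigroup algebra} $K_0S$ is the $K$-algebra with basis $S\setminus\{0\}$ and product extending that of $S$, where the zero of $S$ is identified with the zero of the algebra. An algebra is \emph{simple} if it is non-zero and its only two-sided ideals are $0$ and itself. (1) Let $\mathcal G$ be an ample groupoid. If $L$ is a field with prime field $K$, then $L\mathcal G$ is simple if and only if $K\mathcal G$ is simple. In particular, simplicity depends only on the characteristic: if $K$ and $L$ are any two fields of the same characteristic,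 then $K\mathcal G$ is simple if and only if $L\mathcal G$ is simple. (2) Let $S$ be an inverse semigroup with zero. If $L$ is a field with prime field $K$, then $L_0S$ is simple if and only if $K_0S$ is simple. In particular, if $K$ and $L$ are any two fields of the same characteristic, then $K_0S$ is simple if and only if $L_0S$ is simple. -/

import Mathlib

open Topology

/-- A groupoid presented by its set of arrows. Objects are identified with identity arrows;
`dom g` and `rng g` are the identities at the source and at the target of `g`, and
`comp g h` is the product `gh`, defined when `dom g = rng h`. -/
class ArrowGroupoid (G : Type*) where
  dom : G → G
  rng : G → G
  inv : G → G
  comp : (g h : G) → dom g = rng h → G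
  dom_dom : ∀ g, dom (dom g) = dom g
  rng_dom : ∀ g, rng (dom g) = dom g
  dom_rng : ∀ g, dom (rng g) = rng g
  rng_rng : ∀ g, rng (rng g) = rng g
  dom_comp : ∀ g h (e : dom g = rng h), dom (comp g h e) = dom h
  rng_comp : ∀ g h (e : dom g = rng h), rng (comp g h e) = rng g
  comp_assoc : ∀ g h k (e : dom g = rng h) (e' : dom h = rng k),
    comp (comp g h e) k ((dom_comp g h e).trans e') =
      comp g (comp h k e') (e.trans (rng_comp h k e').symm)
  comp_dom : ∀ g, comp g (dom g) (rng_dom g).symm = g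
  rng_comp_self : ∀ g, comp (rng g) g (dom_rng g) = g
  dom_inv : ∀ g, dom (inv g) = rng g
  rng_inv : ∀ g, rng (inv g) = dom g
  inv_comp : ∀ g, comp (inv g) g (dom_inv g) = dom g
  comp_inv : ∀ g, comp g (inv g) (rng_inv g).symm = rng g

namespace ArrowGroupoid

/-- The unit space: the set of identity arrows. -/
def unitSpace (G : Type*) [ArrowGroupoid G] : Set G := Set.range dom

section Algebra

variable {G : Type*} [ArrowGroupoid G]

/-- The domain map with values in the unit space. -/
def domU (g : G) : unitSpace G := ⟨dom g, g, rfl⟩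

/-- The range map with values in the unit space. -/
def rngU (g : G) : unitSpace G := ⟨rng g, rng g, dom_rng g⟩

/-- `IsProd g h k` says that `g` and `h` are composable with product `k`. -/
def IsProd (g h k : G) : Prop := ∃ e : dom g = rng h, comp g h e = k

/-- The product `UV` of two sets of arrows. -/
def setProd (U V : Set G) : Set G := {k | ∃ g ∈ U, ∃ h ∈ V, IsProd g h k}

theorem domU_eq {g h : G} : domU g = domU h ↔ dom g = dom h := Subtype.ext_iff

theorem rngU_eq {g h : G} : rngU g = rngU h ↔ rng g = rng h := Subtype.ext_iff

theorem comp_congr {g g' h h' : G} (hg : g = g') (hh : h = h') (e : dom g = rng h) :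
    comp g h e = comp g' h' (by rw [← hg, ← hh]; exact e) := by
  subst hg; subst hh; rfl

theorem inv_inv (g : G) : inv (inv g) = g := by
  have h1 : dom (inv (inv g)) = rng (inv g) := dom_inv _
  have h2 : dom (inv g) = rng g := dom_inv _
  have h := comp_assoc (inv (inv g)) (inv g) g h1 h2
  rw [comp_congr (inv_comp (inv g)) rfl, comp_congr (h := comp _ _ _) rfl (inv_comp g)] at h
  rw [comp_congr (g := dom (inv g)) (dom_inv g) rfl, rng_comp_self] at h
  have h3 : dom g = dom (inv (inv g)) := by rw [dom_inv, rng_inv]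
  rw [comp_congr (h := dom g) rfl h3, comp_dom] at h
  exact h.symm

theorem IsProd.eq_comp_inv {g h k : G} (H : IsProd g h k) :
    ∃ e : dom k = rng (inv h), g = comp k (inv h) e := by
  obtain ⟨e, rfl⟩ := H
  refine ⟨by rw [dom_comp, rng_inv], ?_⟩
  rw [comp_assoc g h (inv h) e (rng_inv h).symm, comp_congr (h := comp _ _ _) rfl (comp_inv h),
    comp_congr (h := rng h) rfl e.symm, comp_dom]

theorem isProd_comp_inv {h k : G} (e : dom k = rng (inv h)) :
    IsProd (comp k (inv h) e) h k := by
  refine ⟨by rw [dom_comp, dom_inv], ?_⟩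
  rw [comp_assoc k (inv h) h e (dom_inv h), comp_congr (h := comp _ _ _) rfl (inv_comp h),
    comp_congr (h := dom h) rfl ((rng_inv h).symm.trans e.symm), comp_dom]

theorem IsProd.dom_eq {g h k : G} (H : IsProd g h k) : dom k = dom h := by
  obtain ⟨e, rfl⟩ := H; exact dom_comp _ _ _

theorem IsProd.rng_eq {g h k : G} (H : IsProd g h k) : rng k = rng g := by
  obtain ⟨e, rfl⟩ := H; exact rng_comp _ _ _

theorem IsProd.left_unique {g g' h k : G} (H : IsProd g h k) (H' : IsProd g' h k) : g = g' := by
  obtain ⟨_, h1⟩ := H.eq_comp_inv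
  obtain ⟨_, h2⟩ := H'.eq_comp_inv
  rw [h1, h2]

theorem IsProd.unique {g h k k' : G} (H : IsProd g h k) (H' : IsProd g h k') : k = k' := by
  obtain ⟨_, rfl⟩ := H
  obtain ⟨_, rfl⟩ := H'
  rfl

theorem setProd_assoc (U V W : Set G) :
    setProd (setProd U V) W = setProd U (setProd V W) := by
  ext k
  constructor
  · rintro ⟨_, ⟨a, ha, b, hb, e, rfl⟩, c, hc, e', rfl⟩
    have e2 : dom b = rng c := (dom_comp a b e).symm.trans e'
    exact ⟨a, ha, comp b c e2, ⟨b, hb, c, hc, e2, rfl⟩,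
      e.trans (rng_comp b c e2).symm, (comp_assoc a b c e e2).symm⟩
  · rintro ⟨a, ha, _, ⟨b, hb, c, hc, e, rfl⟩, e', rfl⟩
    have e2 : dom a = rng b := e'.trans (rng_comp b c e)
    exact ⟨comp a b e2, ⟨a, ha, b, hb, e2, rfl⟩, c, hc,
      (dom_comp a b e2).trans e, comp_assoc a b c e2 e⟩

end Algebra

/-- An ample groupoid: a topological groupoid which is étale (the domain map onto the unit space,
with its subspace topology, is a local homeomorphism) and whose unit space is locally compact,
Hausdorff and has a basis of compact open sets. The space of arrows need not be Hausdorff. -/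
class IsAmple (G : Type*) [TopologicalSpace G] [ArrowGroupoid G] : Prop where
  continuous_dom : Continuous (dom : G → G)
  continuous_rng : Continuous (rng : G → G)
  continuous_inv : Continuous (inv : G → G)
  continuous_comp :
    Continuous fun p : {p : G × G // dom p.1 = rng p.2} => comp p.1.1 p.1.2 p.2
  isLocalHomeomorph_domU : IsLocalHomeomorph (domU : G → unitSpace G)
  locallyCompact : LocallyCompactSpace (unitSpace G)
  t2 : T2Space (unitSpace G)
  basis : TopologicalSpace.IsTopologicalBasis
    {U : Set (unitSpace G) | IsCompact U ∧ IsOpen U}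

/-- A compact local bisection: a compact open set of arrows on which the domain and the range
maps are homeomorphisms onto their images in the unit space. -/
structure IsCompactLocalBisection {G : Type*} [TopologicalSpace G] [ArrowGroupoid G]
    (U : Set G) : Prop where
  isCompact : IsCompact U
  isOpen : IsOpen U
  isEmbedding_dom : IsEmbedding (U.domRestrict domU)
  isEmbedding_rng : IsEmbedding (U.domRestrict rngU)

section Topology

variable {G : Type*} [TopologicalSpace G] [ArrowGroupoid G]

theorem IsCompactLocalBisection.eq_of_dom {U : Set G} (hU : IsCompactLocalBisection U) {g h : G}
    (hg : g ∈ U) (hh : h ∈ U) (e : dom g = dom h) : g = h :=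
  congrArg Subtype.val
    (hU.isEmbedding_dom.injective (a₁ := ⟨g, hg⟩) (a₂ := ⟨h, hh⟩) (domU_eq.2 e))

theorem IsCompactLocalBisection.eq_of_rng {U : Set G} (hU : IsCompactLocalBisection U) {g h : G}
    (hg : g ∈ U) (hh : h ∈ U) (e : rng g = rng h) : g = h :=
  congrArg Subtype.val
    (hU.isEmbedding_rng.injective (a₁ := ⟨g, hg⟩) (a₂ := ⟨h, hh⟩) (rngU_eq.2 e))

variable [IsAmple G]

theorem continuous_rngU : Continuous (rngU : G → unitSpace G) :=
  IsAmple.continuous_rng.subtype_mk _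

theorem continuous_domU : Continuous (domU : G → unitSpace G) :=
  IsAmple.continuous_dom.subtype_mk _

theorem isOpenMap_domU : IsOpenMap (domU : G → unitSpace G) :=
  IsAmple.isLocalHomeomorph_domU.isOpenMap

theorem isOpenMap_rngU : IsOpenMap (rngU : G → unitSpace G) := by
  have h : (rngU : G → unitSpace G) = domU ∘ inv := by
    funext g; exact Subtype.ext (dom_inv g).symm
  rw [h]
  exact isOpenMap_domU.comp (Homeomorph.mk ⟨inv, inv, inv_inv, inv_inv⟩
    IsAmple.continuous_inv IsAmple.continuous_inv).isOpenMap

theorem IsCompactLocalBisection.of_injOn {U : Set G} (hc : IsCompact U) (ho : IsOpen U)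
    (hd : Set.InjOn (dom : G → G) U) (hr : Set.InjOn (rng : G → G) U) :
    IsCompactLocalBisection U where
  isCompact := hc
  isOpen := ho
  isEmbedding_dom := (IsOpenEmbedding.of_continuous_injective_isOpenMap
    (continuous_domU.comp continuous_subtype_val)
    (fun a b hab => Subtype.ext (hd a.2 b.2 (domU_eq.1 hab)))
    (isOpenMap_domU.domRestrict ho)).isEmbedding
  isEmbedding_rng := (IsOpenEmbedding.of_continuous_injective_isOpenMap
    (continuous_rngU.comp continuous_subtype_val)
    (fun a b hab => Subtype.ext (hr a.2 b.2 (rngU_eq.1 hab)))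
    (isOpenMap_rngU.domRestrict ho)).isEmbedding

theorem isCompact_setProd {U V : Set G} (hU : IsCompact U) (hV : IsCompact V) :
    IsCompact (setProd U V) := by
  have := IsAmple.t2 (G := G)
  have hcl : IsClosed {p : G × G | dom p.1 = rng p.2} := by
    have : {p : G × G | dom p.1 = rng p.2} = {p : G × G | domU p.1 = rngU p.2} := by
      ext p; exact (Subtype.ext_iff (a1 := domU p.1) (a2 := rngU p.2)).symm
    rw [this]
    exact isClosed_eq (continuous_domU.comp continuous_fst) (continuous_rngU.comp continuous_snd)
  have hK : IsCompact
      (Subtype.val ⁻¹' (U ×ˢ V) : Set {p : G × G // dom p.1 = rng p.2}) :=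
    hcl.isClosedEmbedding_subtypeVal.isCompact_preimage (hU.prod hV)
  convert hK.image IsAmple.continuous_comp using 1
  ext k
  constructor
  · rintro ⟨g, hg, h, hh, e, rfl⟩
    exact ⟨⟨(g, h), e⟩, ⟨hg, hh⟩, rfl⟩
  · rintro ⟨⟨⟨g, h⟩, e⟩, ⟨hg, hh⟩, rfl⟩
    exact ⟨g, hg, h, hh, e, rfl⟩

theorem isOpen_setProd {U V : Set G} (hU : IsOpen U) (hV : IsCompactLocalBisection V) :
    IsOpen (setProd U V) := by
  let W : Set G := domU ⁻¹' (domU '' V)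
  have hW : IsOpen W := (isOpenMap_domU V hV.isOpen).preimage continuous_domU
  let φ := hV.isEmbedding_dom.toHomeomorph
  have hr : ∀ w : W, domU w.1 ∈ Set.range (V.domRestrict (domU (G := G))) := fun w => by
    obtain ⟨v, hv, e⟩ := w.2
    exact ⟨⟨v, hv⟩, e⟩
  let σ : W → V := fun w => φ.symm ⟨domU w.1, hr w⟩
  have hσc : Continuous σ := φ.symm.continuous.comp
    ((continuous_domU.comp continuous_subtype_val).subtype_mk _)
  have hσ : ∀ w : W, dom (σ w).1 = dom w.1 := fun w =>
    domU_eq.1 (congrArg Subtype.val (φ.apply_symm_apply ⟨domU w.1, hr w⟩))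
  have he : ∀ w : W, dom w.1 = rng (inv (σ w).1) := fun w => by rw [rng_inv, hσ]
  let τ : W → G := fun w => comp w.1 (inv (σ w).1) (he w)
  have hτ : Continuous τ := IsAmple.continuous_comp.comp
    (((continuous_subtype_val.prodMk (IsAmple.continuous_inv.comp
      (continuous_subtype_val.comp hσc))).subtype_mk he))
  have hEq : setProd U V = Subtype.val '' (τ ⁻¹' U) := by
    ext k
    constructor
    · rintro ⟨g, hg, h, hh, H⟩
      have hk : k ∈ W := ⟨h, hh, domU_eq.2 H.dom_eq.symm⟩
      refine ⟨⟨k, hk⟩, ?_, rfl⟩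
      have h1 : (σ ⟨k, hk⟩).1 = h :=
        hV.eq_of_dom (σ ⟨k, hk⟩).2 hh ((hσ ⟨k, hk⟩).trans H.dom_eq)
      have h2 : IsProd (τ ⟨k, hk⟩) (σ ⟨k, hk⟩).1 k := isProd_comp_inv (he ⟨k, hk⟩)
      rw [h1] at h2
      change τ ⟨k, hk⟩ ∈ U
      rw [h2.left_unique H]
      exact hg
    · rintro ⟨w, hw, rfl⟩
      exact ⟨τ w, hw, (σ w).1, (σ w).2, isProd_comp_inv (he w)⟩
  rw [hEq]
  exact hW.isOpenMap_subtype_val _ (hU.preimage hτ)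

theorem IsCompactLocalBisection.setProd {U V : Set G} (hU : IsCompactLocalBisection U)
    (hV : IsCompactLocalBisection V) : IsCompactLocalBisection (setProd U V) := by
  refine .of_injOn (isCompact_setProd hU.isCompact hV.isCompact) (isOpen_setProd hU.isOpen hV)
    ?_ ?_
  · rintro k ⟨g, hg, h, hh, H⟩ k' ⟨g', hg', h', hh', H'⟩ e
    have e1 : h = h' := hV.eq_of_dom hh hh' (by rw [← H.dom_eq, ← H'.dom_eq]; exact e)
    subst e1
    have e2 : g = g' := hU.eq_of_dom hg hg' (H.1.trans H'.1.symm)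
    subst e2
    exact H.unique H'
  · rintro k ⟨g, hg, h, hh, H⟩ k' ⟨g', hg', h', hh', H'⟩ e
    have e1 : g = g' := hU.eq_of_rng hg hg' (by rw [← H.rng_eq, ← H'.rng_eq]; exact e)
    subst e1
    have e2 : h = h' := hV.eq_of_rng hh hh' (H.1.symm.trans H'.1)
    subst e2
    exact H.unique H'

end Topology

/-- The convolution `(f * g)(k) = ∑_{ab = k} f(a) g(b)`. The sum has finite support whenever
`f` and `g` are in the Steinberg algebra (`finite_support_conv`). -/
noncomputable def conv {K G : Type*} [CommRing K] [ArrowGroupoid G] (f g : G → K) : G → K :=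
  fun k => ∑ᶠ p : {p : G × G // IsProd p.1 p.2 k}, f p.1.1 * g p.1.2

/-- The underlying module of the Steinberg algebra `KG`: the `K`-span in `G → K` of the
characteristic functions of the compact local bisections. Its ring structure, with convolution
as product, is given below. -/
def SteinbergAlgebra (K G : Type*) [CommRing K] [TopologicalSpace G] [ArrowGroupoid G] :
    Submodule K (G → K) :=
  Submodule.span K {f | ∃ U : Set G, IsCompactLocalBisection U ∧ f = U.indicator 1}

section Steinberg

variable {K G : Type*} [CommRing K] [TopologicalSpace G] [ArrowGroupoid G]

theorem finite_fiber {f : G → K} (hf : f ∈ SteinbergAlgebra K G) (x : G) :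
    {b : G | dom b = x ∧ f b ≠ 0}.Finite := by
  induction hf using Submodule.span_induction with
  | mem f hf =>
    obtain ⟨U, hU, rfl⟩ := hf
    refine Set.Subsingleton.finite ?_
    rintro a ⟨ha, ha'⟩ b ⟨hb, hb'⟩
    exact hU.eq_of_dom (Set.mem_of_indicator_ne_zero ha') (Set.mem_of_indicator_ne_zero hb')
      (ha.trans hb.symm)
  | zero => simp
  | add f g _ _ hf hg =>
    refine (hf.union hg).subset ?_
    rintro b ⟨hb, hb'⟩
    by_cases h : f b = 0
    · refine Or.inr ⟨hb, fun h' => hb' ?_⟩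
      simp [h, h']
    · exact Or.inl ⟨hb, h⟩
  | smul c f _ hf =>
    refine hf.subset ?_
    rintro b ⟨hb, hb'⟩
    exact ⟨hb, fun h => hb' (by simp [h])⟩

theorem finite_support_conv (f : G → K) {g : G → K} (hg : g ∈ SteinbergAlgebra K G) (k : G) :
    (Function.support
      fun p : {p : G × G // IsProd p.1 p.2 k} => f p.1.1 * g p.1.2).Finite := by
  refine Set.Finite.of_finite_image (f := fun p => p.1.2) ((finite_fiber hg (dom k)).subset ?_) ?_
  · rintro _ ⟨p, hp, rfl⟩
    exact ⟨p.2.dom_eq.symm, right_ne_zero_of_mul hp⟩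
  · rintro ⟨⟨a, b⟩, H⟩ _ ⟨⟨a', b'⟩, H'⟩ _ (e : b = b')
    subst e
    exact Subtype.ext (Prod.ext (H.left_unique H') rfl)

theorem conv_add (f : G → K) {g h : G → K} (hg : g ∈ SteinbergAlgebra K G)
    (hh : h ∈ SteinbergAlgebra K G) : conv f (g + h) = conv f g + conv f h := by
  funext k
  simp only [conv, Pi.add_apply, mul_add]
  exact finsum_add_distrib (finite_support_conv f hg k) (finite_support_conv f hh k)

theorem add_conv (f g : G → K) {h : G → K} (hh : h ∈ SteinbergAlgebra K G) :
    conv (f + g) h = conv f h + conv g h := by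
  funext k
  simp only [conv, Pi.add_apply, add_mul]
  exact finsum_add_distrib (finite_support_conv f hh k) (finite_support_conv g hh k)

theorem smul_conv (c : K) (f : G → K) {g : G → K} (hg : g ∈ SteinbergAlgebra K G) :
    conv (c • f) g = c • conv f g := by
  funext k
  simp only [conv, Pi.smul_apply, smul_eq_mul, mul_assoc]
  exact (mul_finsum' _ c (finite_support_conv f hg k)).symm

theorem conv_smul (c : K) (f : G → K) {g : G → K} (hg : g ∈ SteinbergAlgebra K G) :
    conv f (c • g) = c • conv f g := by
  funext k
  simp only [conv, Pi.smul_apply, smul_eq_mul, mul_left_comm _ c]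
  exact (mul_finsum' _ c (finite_support_conv f hg k)).symm

theorem zero_conv {K G : Type*} [CommRing K] [ArrowGroupoid G] (g : G → K) : conv 0 g = 0 := by
  funext k; simp [conv]

theorem conv_zero {K G : Type*} [CommRing K] [ArrowGroupoid G] (g : G → K) : conv g 0 = 0 := by
  funext k; simp [conv]

theorem conv_indicator {U V : Set G} (hU : IsCompactLocalBisection U)
    (hV : IsCompactLocalBisection V) :
    conv (U.indicator 1) (V.indicator (1 : G → K)) = (setProd U V).indicator 1 := by
  classical
  funext k
  by_cases hk : k ∈ setProd U V
  · obtain ⟨g, hg, h, hh, H⟩ := hk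
    rw [Set.indicator_of_mem (show k ∈ setProd U V from ⟨g, hg, h, hh, H⟩)]
    rw [conv, finsum_eq_single _ ⟨(g, h), H⟩]
    · simp [hg, hh]
    · rintro ⟨⟨g', h'⟩, H'⟩ hne
      by_contra hp
      have hg' : g' ∈ U := Set.mem_of_indicator_ne_zero (left_ne_zero_of_mul hp)
      have hh' : h' ∈ V := Set.mem_of_indicator_ne_zero (right_ne_zero_of_mul hp)
      refine hne (Subtype.ext (Prod.ext ?_ ?_))
      · exact hU.eq_of_rng hg' hg (H'.rng_eq.symm.trans H.rng_eq)
      · exact hV.eq_of_dom hh' hh (H'.dom_eq.symm.trans H.dom_eq)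
  · rw [Set.indicator_of_notMem hk]
    refine finsum_eq_zero_of_forall_eq_zero ?_
    rintro ⟨⟨g', h'⟩, H'⟩
    by_contra hp
    exact hk ⟨g', Set.mem_of_indicator_ne_zero (left_ne_zero_of_mul hp), h',
      Set.mem_of_indicator_ne_zero (right_ne_zero_of_mul hp), H'⟩

theorem indicator_mem {U : Set G} (hU : IsCompactLocalBisection U) :
    U.indicator (1 : G → K) ∈ SteinbergAlgebra K G :=
  Submodule.subset_span ⟨U, hU, rfl⟩

variable [IsAmple G]

theorem conv_mem {f g : G → K} (hf : f ∈ SteinbergAlgebra K G) (hg : g ∈ SteinbergAlgebra K G) :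
    conv f g ∈ SteinbergAlgebra K G := by
  induction hf using Submodule.span_induction with
  | mem f hf =>
    obtain ⟨U, hU, rfl⟩ := hf
    induction hg using Submodule.span_induction with
    | mem g hg =>
      obtain ⟨V, hV, rfl⟩ := hg
      rw [conv_indicator hU hV]
      exact indicator_mem (hU.setProd hV)
    | zero => rw [conv_zero]; exact Submodule.zero_mem _
    | add g h hg hh ihg ihh => rw [conv_add _ hg hh]; exact Submodule.add_mem _ ihg ihh
    | smul c g hg ihg => rw [conv_smul _ _ hg]; exact Submodule.smul_mem _ _ ihg
  | zero => rw [zero_conv]; exact Submodule.zero_mem _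
  | add f h _ _ ihf ihh => rw [add_conv _ _ hg]; exact Submodule.add_mem _ ihf ihh
  | smul c f _ ihf => rw [smul_conv _ _ hg]; exact Submodule.smul_mem _ _ ihf

theorem conv_assoc {f g h : G → K} (hf : f ∈ SteinbergAlgebra K G)
    (hg : g ∈ SteinbergAlgebra K G) (hh : h ∈ SteinbergAlgebra K G) :
    conv (conv f g) h = conv f (conv g h) := by
  induction hf using Submodule.span_induction with
  | mem f hf =>
    obtain ⟨U, hU, rfl⟩ := hf
    induction hg using Submodule.span_induction with
    | mem g hg =>
      obtain ⟨V, hV, rfl⟩ := hg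
      induction hh using Submodule.span_induction with
      | mem h hh =>
        obtain ⟨W, hW, rfl⟩ := hh
        rw [conv_indicator hU hV, conv_indicator hV hW, conv_indicator (hU.setProd hV) hW,
          conv_indicator hU (hV.setProd hW), setProd_assoc]
      | zero => simp only [conv_zero]
      | add h h' hh hh' ih ih' =>
        rw [conv_add _ hh hh', conv_add _ hh hh',
          conv_add _ (conv_mem (indicator_mem hV) hh) (conv_mem (indicator_mem hV) hh'), ih, ih']
      | smul c h hh ih =>
        rw [conv_smul _ _ hh, conv_smul _ _ hh, conv_smul _ _ (conv_mem (indicator_mem hV) hh), ih]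
    | zero => simp only [conv_zero, zero_conv]
    | add g g' hg hg' ih ih' =>
      rw [conv_add _ hg hg', add_conv _ _ hh, add_conv _ _ hh,
        conv_add _ (conv_mem hg hh) (conv_mem hg' hh), ih, ih']
    | smul c g hg ih =>
      rw [conv_smul _ _ hg, smul_conv _ _ hh, smul_conv _ _ hh,
        conv_smul _ _ (conv_mem hg hh), ih]
  | zero => simp only [zero_conv]
  | add f f' _ _ ih ih' =>
    rw [add_conv _ _ hg, add_conv _ _ hh, add_conv _ _ (conv_mem hg hh), ih, ih']
  | smul c f hf ih =>
    rw [smul_conv _ _ hg, smul_conv _ _ hh, smul_conv _ _ (conv_mem hg hh), ih]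

/-- The Steinberg algebra with the convolution product. -/
noncomputable instance : NonUnitalRing (SteinbergAlgebra K G) where
  mul f g := ⟨conv f.1 g.1, conv_mem f.2 g.2⟩
  left_distrib f g h := Subtype.ext (conv_add f.1 g.2 h.2)
  right_distrib f g h := Subtype.ext (add_conv f.1 g.1 h.2)
  zero_mul f := Subtype.ext (zero_conv f.1)
  mul_zero f := Subtype.ext (conv_zero f.1)
  mul_assoc f g h := Subtype.ext (conv_assoc f.2 g.2 h.2)

instance : IsScalarTower K (SteinbergAlgebra K G) (SteinbergAlgebra K G) :=
  ⟨fun c f g => Subtype.ext (smul_conv c f.1 g.2)⟩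

instance : SMulCommClass K (SteinbergAlgebra K G) (SteinbergAlgebra K G) :=
  ⟨fun c f g => Subtype.ext (conv_smul c f.1 g.2).symm⟩

end Steinberg

end ArrowGroupoid

/-- An inverse semigroup: every `s` has a unique `t` with `s t s = s` and `t s t = t`. -/
def IsInverseSemigroup (S : Type*) [Semigroup S] : Prop :=
  ∀ s : S, ∃! t : S, s * t * s = s ∧ t * s * t = t

/-- The contracted semigroup algebra `K₀S`: the free `K`-module on `S \ {0}`, with the product
(given below) extending that of `S`, the zero of `S` being identified with `0`. -/
def ContractedAlgebra (K S : Type*) [CommRing K] [Zero S] : Type _ := {s : S // s ≠ 0} →₀ K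

namespace ContractedAlgebra

section Module

variable (K S : Type*) [CommRing K] [Zero S]

noncomputable instance : AddCommGroup (ContractedAlgebra K S) :=
  inferInstanceAs (AddCommGroup ({s : S // s ≠ 0} →₀ K))

noncomputable instance : Module K (ContractedAlgebra K S) :=
  inferInstanceAs (Module K ({s : S // s ≠ 0} →₀ K))

/-- The basis of `K₀S` indexed by `S \ {0}`. -/
noncomputable def basis : Module.Basis {s : S // s ≠ 0} K (ContractedAlgebra K S) :=
  Module.Basis.ofRepr (LinearEquiv.refl K ({s : S // s ≠ 0} →₀ K))

open Classical in
/-- The natural map `S → K₀S`, a basis vector at each non-zero `s`, and `0` at `0`. -/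
noncomputable def of (s : S) : ContractedAlgebra K S :=
  if h : s = 0 then 0 else basis K S ⟨s, h⟩

theorem of_zero : of K S 0 = 0 := by simp [of]

theorem of_coe (s : {s : S // s ≠ 0}) : of K S s = basis K S s := by simp [of, s.2]

end Module

variable (K S : Type*) [CommRing K] [SemigroupWithZero S]

/-- The bilinear product on `K₀S` determined by the product of `S` on basis vectors. -/
noncomputable def mulMap :
    ContractedAlgebra K S →ₗ[K] ContractedAlgebra K S →ₗ[K] ContractedAlgebra K S :=
  (basis K S).constr K fun s => (basis K S).constr K fun t => of K S (s * t)

theorem mulMap_of (s t : S) : mulMap K S (of K S s) (of K S t) = of K S (s * t) := by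
  by_cases hs : s = 0
  · simp [hs, of_zero]
  by_cases ht : t = 0
  · simp [ht, of_zero]
  have h1 := of_coe K S ⟨s, hs⟩
  have h2 := of_coe K S ⟨t, ht⟩
  simp only at h1 h2
  rw [h1, h2, mulMap, Module.Basis.constr_basis, Module.Basis.constr_basis]

theorem induction_on {p : ContractedAlgebra K S → Prop} (a : ContractedAlgebra K S)
    (of : ∀ s : S, p (of K S s)) (add : ∀ a b, p a → p b → p (a + b))
    (smul : ∀ (c : K) a, p a → p (c • a)) : p a := by
  induction (basis K S).mem_span a using Submodule.span_induction with
  | mem a ha =>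
    obtain ⟨s, rfl⟩ := ha
    rw [← of_coe]
    exact of s
  | zero => exact of_zero K S ▸ of 0
  | add a b _ _ ha hb => exact add a b ha hb
  | smul c a _ ha => exact smul c a ha

theorem mulMap_assoc (a b c : ContractedAlgebra K S) :
    mulMap K S (mulMap K S a b) c = mulMap K S a (mulMap K S b c) := by
  induction a using induction_on with
  | of s =>
    induction b using induction_on with
    | of t =>
      induction c using induction_on with
      | of u => simp only [mulMap_of, mul_assoc]
      | add c c' h h' => simp only [map_add, h, h']
      | smul r c h => simp only [map_smul, h]
    | add b b' h h' => simp only [map_add, LinearMap.add_apply, h, h']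
    | smul r b h => simp only [map_smul, LinearMap.smul_apply, h]
  | add a a' h h' => simp only [map_add, LinearMap.add_apply, h, h']
  | smul r a h => simp only [map_smul, LinearMap.smul_apply, h]

noncomputable instance : NonUnitalRing (ContractedAlgebra K S) where
  mul a b := mulMap K S a b
  left_distrib a b c := map_add (mulMap K S a) b c
  right_distrib a b c := LinearMap.map_add₂ (mulMap K S) a b c
  zero_mul a := LinearMap.map_zero₂ (mulMap K S) a
  mul_zero a := map_zero (mulMap K S a)
  mul_assoc := mulMap_assoc K S

instance : IsScalarTower K (ContractedAlgebra K S) (ContractedAlgebra K S) :=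
  ⟨fun c a b => LinearMap.map_smul₂ (mulMap K S) c a b⟩

instance : SMulCommClass K (ContractedAlgebra K S) (ContractedAlgebra K S) :=
  ⟨fun c a b => (map_smul (mulMap K S a) c b).symm⟩

end ContractedAlgebra

/-! Both statements are cases of one: for a field extension `L/K`, the `L`-algebra `B = L ⊗ A` is
simple iff the `K`-algebra `A` is. Tensor products are avoided: for a basis `β` of `L` over `K`,
each element of `B` is uniquely a combination `∑ βⱼ aⱼ` with coefficients in `A`
(`IsScalarExtension`).

Descent is formal. The elements of `B` with all coefficients in an ideal `I` of `A` form an ideal,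
and `I` can be read off from it (`mem_extendIdeal`).

Ascent fails for a general simple algebra, since its centre may be larger than `K`. It does hold
once `A` has a nonzero idempotent `e` such that the centre of `eAe` is `Ke` (`IsCentralCorner`).
Take a nonzero element of an ideal of `B` with as few nonzero coefficients as possible. Simplicity
of `A` allows one coefficient to be turned into `e` and the others to be pushed into `eAe`.
Commutators with elements of `eAe` lose that coefficient, so they vanish by minimality. All
coefficients are then central in `eAe`, hence in `Ke`, and the ideal contains a nonzero multiple of
`e` (`exists_smul_mem`).

The idempotent comes from a representation of `A` by partial permutations of a basis. Let `e` fix a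
basis vector `δₓ`, and suppose that elements of `eAe` separate `x` from the other points. A central
`c` of `eAe` must then send `δₓ` to some `kδₓ`. The ideal generated by `c - ke` cannot contain `e`,
so `c = ke` by simplicity; faithfulness of the representation is never needed. For a groupoid the
points are the units and `e` is the characteristic function of a compact open set of units. For an
inverse semigroup the points are the nonzero idempotents, with the Munn action, and `e` is any one
of them.

Fields of equal characteristic are compared through their common prime field. -/

/-- A nonunital ring is simple iff it is nontrivial and every two-sided ideal with a nonzero
element is everything. -/
theorem isSimpleRing_iff_nontrivial_and_forall_mem {R : Type*} [NonUnitalNonAssocRing R] :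
    IsSimpleRing R ↔
      Nontrivial R ∧ ∀ I : TwoSidedIdeal R, ∀ x ∈ I, x ≠ 0 → ∀ y, y ∈ I := by
  constructor
  · intro h
    constructor
    · by_contra hR
      rw [not_nontrivial_iff_subsingleton] at hR
      exact bot_ne_top (α := TwoSidedIdeal R)
        (TwoSidedIdeal.ext fun x => by
          rw [Subsingleton.elim x 0]
          exact ⟨fun _ => TwoSidedIdeal.zero_mem _, fun _ => TwoSidedIdeal.zero_mem _⟩)
    · intro I x hx hx0 y
      rcases eq_bot_or_eq_top I with rfl | rfl
      · exact absurd ((TwoSidedIdeal.mem_bot R).1 hx) hx0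
      · trivial
  · rintro ⟨hR, h⟩
    obtain ⟨x, hx⟩ := exists_ne (0 : R)
    refine ⟨{ exists_pair_ne := ⟨⊥, ⊤, fun e => hx ?_⟩, eq_bot_or_eq_top := fun I => ?_ }⟩
    · rw [← TwoSidedIdeal.mem_bot R, e]
      trivial
    · by_cases hI : ∃ x ∈ I, x ≠ 0
      · obtain ⟨x, hx, hx0⟩ := hI
        exact Or.inr (TwoSidedIdeal.ext fun y => ⟨fun _ => trivial, fun _ => h I x hx hx0 y⟩)
      · push Not at hI
        refine Or.inl (TwoSidedIdeal.ext fun y => ?_)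
        rw [TwoSidedIdeal.mem_bot]
        exact ⟨hI y, fun e => e ▸ TwoSidedIdeal.zero_mem _⟩

/-! ### Idempotents whose corner has only scalars in its centre. -/

section CentralCorner

variable {K A : Type*} [Field K] [NonUnitalRing A] [Module K A]

/-- The corner `eAe` at the idempotent `e` has centre `Ke`. -/
structure IsCentralCorner (K : Type*) {A : Type*} [Field K] [NonUnitalRing A] [Module K A]
    (e : A) : Prop where
  ne_zero : e ≠ 0
  mul_self : e * e = e
  exists_smul : ∀ c, e * c = c → c * e = c →
    (∀ b, e * b = b → b * e = b → c * b = b * c) → ∃ k : K, c = k • e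

/-- If a simple algebra acts so that every central element of `eAe` scales a fixed vector `v` with
`ev = v ≠ 0`, then the centre of `eAe` is `Ke`. -/
theorem isCentralCorner_of_eigenvector [IsScalarTower K A A] [SMulCommClass K A A]
    (hA : IsSimpleRing A) {M : Type*} [AddCommGroup M] [Module K M]
    (ρ : A →ₗ[K] Module.End K M) (hρ : ∀ a b, ρ (a * b) = ρ a * ρ b) {e : A} (he : e * e = e)
    {v : M} (hv : v ≠ 0) (hev : ρ e v = v)
    (hc : ∀ c, e * c = c → c * e = c →
      (∀ b, e * b = b → b * e = b → c * b = b * c) → ∃ k : K, ρ c v = k • v) :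
    IsCentralCorner K e := by
  refine ⟨fun h => hv (by rw [← hev, h, map_zero, LinearMap.zero_apply]), he, ?_⟩
  intro c hec hce hcomm
  obtain ⟨k, hk⟩ := hc c hec hce hcomm
  refine ⟨k, ?_⟩
  by_contra hne
  -- This ideal misses `e`, because `e` fixes `v ≠ 0`. It remains to see that it contains `c - ke`.
  let N : TwoSidedIdeal A := TwoSidedIdeal.mk' {y | ∀ a b, ρ (e * a * y * b * e) v = 0}
    (by simp)
    (fun {x y} hx hy a b => by
      simp only [Set.mem_ofPred_eq] at hx hy
      simp [mul_add, add_mul, hx, hy])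
    (fun {x} hx a b => by
      simp only [Set.mem_ofPred_eq] at hx
      simp [hx])
    (fun {x y} hy a b => by
      have := hy (a * x) b
      simpa only [mul_assoc] using this)
    (fun {x y} hx a b => by
      have := hx a (y * b)
      simpa only [mul_assoc] using this)
  have hmem : c - k • e ∈ N := by
    refine (TwoSidedIdeal.mem_mk' _ _ _ _ _ _ _).2 fun a b => ?_
    have h1 : e * (c - k • e) = c - k • e := by rw [mul_sub, hec, mul_smul_comm, he]
    have h2 : (c - k • e) * e = c - k • e := by rw [sub_mul, hce, smul_mul_assoc, he]
    have h3 : (c - k • e) * (e * b * e) = (e * b * e) * (c - k • e) := by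
      have hl : e * (e * b * e) = e * b * e := by rw [← mul_assoc, ← mul_assoc, he]
      have hr : e * b * e * e = e * b * e := by rw [mul_assoc, he]
      rw [sub_mul, mul_sub, hcomm _ hl hr, smul_mul_assoc, mul_smul_comm, hl, hr]
    -- Centrality moves `c - ke` past `ebe`, so that it hits `v` first.
    have h4 : e * a * (c - k • e) * b * e = e * a * (e * b * e) * (c - k • e) := by
      rw [mul_assoc (e * a) (e * b * e), ← h3]
      conv_lhs => rw [← h2]
      simp only [mul_assoc]
    have h5 : ρ (c - k • e) v = 0 := by
      rw [map_sub, map_smul, LinearMap.sub_apply, LinearMap.smul_apply, hk, hev, sub_self]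
    rw [h4, hρ, Module.End.mul_apply, h5, map_zero]
  have hN := (isSimpleRing_iff_nontrivial_and_forall_mem.1 hA).2 N _ hmem (sub_ne_zero.2 hne) e
  have := (TwoSidedIdeal.mem_mk' _ _ _ _ _ _ _).1 hN e e
  rw [he, he, he, he, hev] at this
  exact hv this

/-- A permutation-like version of `isCentralCorner_of_eigenvector`: the vector is a basis vector
`δₓ` which elements of `eAe` separate from all other basis vectors. -/
theorem isCentralCorner_of_separating [IsScalarTower K A A] [SMulCommClass K A A]
    (hA : IsSimpleRing A) {X : Type*} (ρ : A →ₗ[K] Module.End K (X →₀ K))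
    (hρ : ∀ a b, ρ (a * b) = ρ a * ρ b) {e : A} (he : e * e = e) (x : X)
    (hex : ρ e (Finsupp.single x 1) = Finsupp.single x 1)
    (hsep : ∀ y, y ≠ x → (∀ p, ρ e p y = 0) ∨
      ∃ b, e * b = b ∧ b * e = b ∧ ρ b (Finsupp.single x 1) = 0 ∧ ∀ p, ρ b p y = p y) :
    IsCentralCorner K e := by
  refine isCentralCorner_of_eigenvector hA ρ hρ he (by simp) hex fun c hec hce hcomm => ?_
  refine ⟨ρ c (Finsupp.single x 1) x, Finsupp.ext fun y => ?_⟩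
  by_cases hy : y = x
  · subst hy; simp
  · rw [Finsupp.smul_apply, Finsupp.single_eq_of_ne hy, smul_zero]
    -- Either `c = ec` has no coordinate at `y` in its image, or `(cδₓ)(y) = (bcδₓ)(y) = (cbδₓ)(y) =
    -- 0`.
    rcases hsep y hy with h | ⟨b, h1, h2, h3, h4⟩
    · rw [← hec, hρ]
      exact h _
    · rw [← h4, ← Module.End.mul_apply, ← hρ, ← hcomm b h1 h2, hρ, Module.End.mul_apply, h3,
        map_zero, Finsupp.zero_apply]

end CentralCorner

/-! ### Simplicity under extension of scalars. -/

section ScalarExtension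

variable {K L A B J : Type*} [Field K] [Field L] [Algebra K L] [NonUnitalRing A] [Module K A]
  [NonUnitalRing B] [Module L B]

/-- The map `(aⱼ) ↦ ∑ⱼ βⱼ ι(aⱼ)`, where `β` is a family of scalars. -/
noncomputable def scalarCombination (β : J → L) (ι : A →ₙ+* B) : (J →₀ A) →+ B :=
  Finsupp.liftAddHom fun j => (DistribSMul.toAddMonoidHom B (β j)).comp (ι : A →+ B)

theorem scalarCombination_single (β : J → L) (ι : A →ₙ+* B) (j : J) (a : A) :
    scalarCombination β ι (Finsupp.single j a) = β j • ι a := by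
  simp [scalarCombination]

theorem scalarCombination_apply (β : J → L) (ι : A →ₙ+* B) (f : J →₀ A) :
    scalarCombination β ι f = f.sum fun j a => β j • ι a := rfl

/-- `ι` exhibits the `L`-algebra `B` as the extension of scalars of the `K`-algebra `A`. -/
structure IsScalarExtension (β : Module.Basis J K L) (ι : A →ₙ+* B) : Prop where
  map_smul : ∀ (k : K) (a : A), ι (k • a) = algebraMap K L k • ι a
  span_eq_top : Submodule.span L (Set.range ι) = ⊤
  injective : ∀ f : J →₀ A, scalarCombination β ι f = 0 → f = 0

variable {β : Module.Basis J K L} {ι : A →ₙ+* B}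

/-- Elements of `A` act coefficient by coefficient, so they never enlarge the support; the
minimal-support argument rests on this. -/
theorem mul_scalarCombination [SMulCommClass L B B] (β : J → L) (a : A) (f : J →₀ A) :
    ι a * scalarCombination β ι f =
      scalarCombination β ι (Finsupp.mapRange.addMonoidHom (AddMonoidHom.mulLeft a) f) := by
  induction f using Finsupp.induction_linear with
  | zero => simp
  | add f g hf hg => simp only [map_add, mul_add, hf, hg]
  | single j x =>
    rw [Finsupp.mapRange.addMonoidHom_apply, Finsupp.mapRange_single, scalarCombination_single,
      scalarCombination_single, AddMonoidHom.coe_mulLeft, map_mul, mul_smul_comm]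

theorem scalarCombination_mul [IsScalarTower L B B] (β : J → L) (a : A) (f : J →₀ A) :
    scalarCombination β ι f * ι a =
      scalarCombination β ι (Finsupp.mapRange.addMonoidHom (AddMonoidHom.mulRight a) f) := by
  induction f using Finsupp.induction_linear with
  | zero => simp
  | add f g hf hg => simp only [map_add, add_mul, hf, hg]
  | single j x =>
    rw [Finsupp.mapRange.addMonoidHom_apply, Finsupp.mapRange_single, scalarCombination_single,
      scalarCombination_single, AddMonoidHom.mulRight_apply, map_mul, smul_mul_assoc]

namespace IsScalarExtension

theorem smul_map_eq (h : IsScalarExtension β ι) (l : L) (a : A) :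
    l • ι a = scalarCombination β ι ((β.repr l).mapRange (fun k => k • a) (zero_smul K a)) := by
  conv_lhs => rw [← β.linearCombination_repr l]
  induction β.repr l using Finsupp.induction_linear with
  | zero => simp
  | add f g hf hg =>
    rw [Finsupp.mapRange_add (fun _ _ => add_smul _ _ _), map_add, map_add, add_smul, hf, hg]
  | single j k =>
    rw [Finsupp.mapRange_single, scalarCombination_single, h.map_smul,
      Finsupp.linearCombination_single, Algebra.smul_def, smul_smul, mul_comm]

theorem surjective (h : IsScalarExtension β ι) : Function.Surjective (scalarCombination β ι) := by
  intro b
  have hb : b ∈ Submodule.span L (Set.range ι) := h.span_eq_top ▸ Submodule.mem_top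
  induction hb using Submodule.span_induction with
  | mem b hb =>
    obtain ⟨a, rfl⟩ := hb
    exact ⟨_, by rw [← h.smul_map_eq 1 a, one_smul]⟩
  | zero => exact ⟨0, map_zero _⟩
  | add b c _ _ hb hc =>
    obtain ⟨f, rfl⟩ := hb
    obtain ⟨g, rfl⟩ := hc
    exact ⟨f + g, map_add _ _ _⟩
  | smul l b _ hb =>
    obtain ⟨f, rfl⟩ := hb
    rename_i hf
    clear hf
    induction f using Finsupp.induction_linear with
    | zero => exact ⟨0, by simp⟩
    | add f g hf hg =>
      obtain ⟨f', hf⟩ := hf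
      obtain ⟨g', hg⟩ := hg
      exact ⟨f' + g', by rw [map_add, map_add, smul_add, hf, hg]⟩
    | single j a =>
      exact ⟨_, (h.smul_map_eq (l * β j) a).symm.trans
        (by rw [scalarCombination_single, smul_smul])⟩

theorem scalarCombination_injective (h : IsScalarExtension β ι) :
    Function.Injective (scalarCombination β ι) :=
  (injective_iff_map_eq_zero _).2 h.injective

variable [IsScalarTower K A A] [SMulCommClass K A A] [IsScalarTower L B B] [SMulCommClass L B B]

/-- The extension of scalars of a two-sided ideal. -/
noncomputable def extendIdeal (h : IsScalarExtension β ι) (I : TwoSidedIdeal A) :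
    TwoSidedIdeal B :=
  TwoSidedIdeal.mk' {b | ∃ f : J →₀ A, (∀ j, f j ∈ I) ∧ scalarCombination β ι f = b}
    ⟨0, fun _ => I.zero_mem, map_zero _⟩
    (by
      rintro _ _ ⟨f, hf, rfl⟩ ⟨g, hg, rfl⟩
      exact ⟨f + g, fun j => I.add_mem (hf j) (hg j), map_add _ _ _⟩)
    (by
      rintro _ ⟨f, hf, rfl⟩
      exact ⟨-f, fun j => I.neg_mem (hf j), map_neg _ _⟩)
    (by
      rintro b _ ⟨f, hf, rfl⟩
      obtain ⟨g, rfl⟩ := h.surjective b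
      induction g using Finsupp.induction_linear with
      | zero => exact ⟨0, fun _ => I.zero_mem, by simp⟩
      | add g g' hg hg' =>
        obtain ⟨u, hu, hu'⟩ := hg
        obtain ⟨v, hv, hv'⟩ := hg'
        exact ⟨u + v, fun j => I.add_mem (hu j) (hv j), by rw [map_add, map_add, add_mul, hu', hv']⟩
      | single i a =>
        rw [scalarCombination_single, smul_mul_assoc, mul_scalarCombination,
          scalarCombination_apply, Finsupp.smul_sum]
        -- The products `βᵢβₖ` are expanded in the basis again, which mixes the coefficients only by
        -- scalars from `K`.
        simp only [smul_smul]
        simp only [h.smul_map_eq]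
        refine ⟨_, fun j => ?_, map_finsuppSum _ _ _⟩
        rw [Finsupp.sum_apply]
        refine sum_mem fun k _ => ?_
        -- A ring ideal is not assumed stable under `K`; the scalar is absorbed into the factor `a`.
        simp only [Finsupp.mapRange_apply, Finsupp.mapRange.addMonoidHom_apply,
          AddMonoidHom.coe_mulLeft, ← smul_mul_assoc]
        exact I.mul_mem_left _ _ (hf k))
    (by
      rintro _ b ⟨f, hf, rfl⟩
      obtain ⟨g, rfl⟩ := h.surjective b
      induction g using Finsupp.induction_linear with
      | zero => exact ⟨0, fun _ => I.zero_mem, by simp⟩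
      | add g g' hg hg' =>
        obtain ⟨u, hu, hu'⟩ := hg
        obtain ⟨v, hv, hv'⟩ := hg'
        exact ⟨u + v, fun j => I.add_mem (hu j) (hv j), by rw [map_add, map_add, mul_add, hu', hv']⟩
      | single i a =>
        rw [scalarCombination_single, mul_smul_comm, scalarCombination_mul,
          scalarCombination_apply, Finsupp.smul_sum]
        simp only [smul_smul]
        simp only [h.smul_map_eq]
        refine ⟨_, fun j => ?_, map_finsuppSum _ _ _⟩
        rw [Finsupp.sum_apply]
        refine sum_mem fun k _ => ?_
        simp only [Finsupp.mapRange_apply, Finsupp.mapRange.addMonoidHom_apply,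
          AddMonoidHom.mulRight_apply, ← mul_smul_comm]
        exact I.mul_mem_right _ _ (hf k))

/-- By uniqueness of coefficients, extending an ideal loses no information about it. -/
theorem mem_extendIdeal (h : IsScalarExtension β ι) (I : TwoSidedIdeal A) (f : J →₀ A) :
    scalarCombination β ι f ∈ h.extendIdeal I ↔ ∀ j, f j ∈ I := by
  rw [extendIdeal, TwoSidedIdeal.mem_mk']
  constructor
  · rintro ⟨g, hg, e⟩
    rwa [← h.scalarCombination_injective e]
  · exact fun hf => ⟨f, hf, rfl⟩

omit [IsScalarTower K A A] [SMulCommClass K A A] [IsScalarTower L B B] [SMulCommClass L B B] in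
theorem nontrivial_iff (h : IsScalarExtension β ι) : Nontrivial B ↔ Nontrivial A := by
  have : Nonempty J := β.index_nonempty
  have e := (Equiv.ofBijective _ ⟨h.scalarCombination_injective, h.surjective⟩).nontrivial_congr
  rw [← e]
  constructor
  · intro hB
    by_contra hA
    rw [not_nontrivial_iff_subsingleton] at hA
    exact not_subsingleton (J →₀ A) inferInstance
  · intro _
    infer_instance

theorem isSimpleRing_of_extension (h : IsScalarExtension β ι) (hB : IsSimpleRing B) :
    IsSimpleRing A := by
  rw [isSimpleRing_iff_nontrivial_and_forall_mem] at hB ⊢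
  obtain ⟨j⟩ := β.index_nonempty
  refine ⟨h.nontrivial_iff.1 hB.1, fun I x hx hx0 y => ?_⟩
  have hmem : scalarCombination β ι (Finsupp.single j x) ∈ h.extendIdeal I := by
    classical
    rw [h.mem_extendIdeal]
    intro i
    rw [Finsupp.single_apply]
    split_ifs
    exacts [hx, I.zero_mem]
  have := hB.2 _ _ hmem
    (fun e => hx0 (Finsupp.single_eq_zero.1 (h.injective _ e))) (scalarCombination β ι
      (Finsupp.single j y))
  rw [h.mem_extendIdeal] at this
  simpa using this j

omit [IsScalarTower K A A] [SMulCommClass K A A] in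
/-- A nonzero two-sided ideal of the extension of scalars of a simple algebra with a central corner
`eAe` contains a nonzero scalar multiple of `e`. -/
theorem exists_smul_mem (h : IsScalarExtension β ι) (hA : IsSimpleRing A) {e : A}
    (he : IsCentralCorner K e) (I : TwoSidedIdeal B) {x : B} (hx : x ∈ I) (hx0 : x ≠ 0) :
    ∃ l : L, l ≠ 0 ∧ l • ι e ∈ I := by
  classical
  obtain ⟨f₀, rfl⟩ := h.surjective x
  -- A shortest nonzero element of `I`, in the number of its nonzero coefficients.
  obtain ⟨f, ⟨hf0, hf⟩, hmin⟩ := WellFounded.has_min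
    (measure fun f : J →₀ A => f.support.card).wf
    {f | f ≠ 0 ∧ scalarCombination β ι f ∈ I} ⟨f₀, fun e => hx0 (by rw [e, map_zero]), hx⟩
  obtain ⟨i, hi⟩ := Finsupp.ne_iff.1 hf0
  -- The possible `i`-th coefficients of elements of `I` supported within the support of `f`. This
  -- ideal contains `f i ≠ 0`, hence also `e`.
  let N : TwoSidedIdeal A := TwoSidedIdeal.mk'
    {y | ∃ g : J →₀ A, scalarCombination β ι g ∈ I ∧ (∀ j, f j = 0 → g j = 0) ∧ g i = y}
    ⟨0, by simp [I.zero_mem], by simp, rfl⟩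
    (by
      rintro _ _ ⟨g, hg, hg', rfl⟩ ⟨g₁, hg₁, hg₁', rfl⟩
      exact ⟨g + g₁, by rw [map_add]; exact I.add_mem hg hg₁,
        fun j hj => by simp [hg' j hj, hg₁' j hj], rfl⟩)
    (by
      rintro _ ⟨g, hg, hg', rfl⟩
      exact ⟨-g, by rw [map_neg]; exact I.neg_mem hg, fun j hj => by simp [hg' j hj], rfl⟩)
    (by
      rintro a _ ⟨g, hg, hg', rfl⟩
      exact ⟨_, by rw [← mul_scalarCombination]; exact I.mul_mem_left (ι a) _ hg,
        fun j hj => by simp [hg' j hj], by simp⟩)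
    (by
      rintro _ a ⟨g, hg, hg', rfl⟩
      exact ⟨_, by rw [← scalarCombination_mul]; exact I.mul_mem_right _ (ι a) hg,
        fun j hj => by simp [hg' j hj], by simp⟩)
  have hfN : f i ∈ N := (TwoSidedIdeal.mem_mk' _ _ _ _ _ _ _).2 ⟨f, hf, fun _ => id, rfl⟩
  obtain ⟨g, hg, hg0, hgi⟩ := (TwoSidedIdeal.mem_mk' _ _ _ _ _ _ _).1
    ((isSimpleRing_iff_nontrivial_and_forall_mem.1 hA).2 N _ hfN hi e)
  -- Multiplying by `e` on both sides puts all coefficients in `eAe` and keeps the `i`-th equal to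
  -- `e`.
  obtain ⟨g, hg, hg0, hgi, hge, hge'⟩ : ∃ g : J →₀ A, scalarCombination β ι g ∈ I ∧
      (∀ j, f j = 0 → g j = 0) ∧ g i = e ∧ (∀ j, e * g j = g j) ∧ ∀ j, g j * e = g j := by
    refine ⟨Finsupp.mapRange.addMonoidHom (AddMonoidHom.mulRight e)
      (Finsupp.mapRange.addMonoidHom (AddMonoidHom.mulLeft e) g), ?_, ?_, ?_, ?_, ?_⟩
    · rw [← scalarCombination_mul, ← mul_scalarCombination]
      exact I.mul_mem_right _ _ (I.mul_mem_left _ _ hg)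
    · intro j hj
      simp [hg0 j hj]
    · simp [hgi, he.mul_self]
    · intro j
      simp [← mul_assoc, he.mul_self]
    · intro j
      simp [mul_assoc, he.mul_self]
  have hcomm : ∀ j, ∃ k : K, g j = k • e := by
    intro j
    refine he.exists_smul _ (hge j) (hge' j) fun b hb hb' => ?_
    -- The commutator with `b ∈ eAe` has `i`-th coefficient `eb - be = 0`, so its support is
    -- strictly smaller than that of `f`.
    let u : J →₀ A := Finsupp.mapRange.addMonoidHom (AddMonoidHom.mulRight b) g -
      Finsupp.mapRange.addMonoidHom (AddMonoidHom.mulLeft b) g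
    have hu : ∀ j, u j = g j * b - b * g j := fun j => by simp [u]
    have huI : scalarCombination β ι u ∈ I := by
      rw [map_sub, ← scalarCombination_mul, ← mul_scalarCombination]
      exact I.sub_mem (I.mul_mem_right _ _ hg) (I.mul_mem_left _ _ hg)
    by_contra hne
    refine hmin u ⟨fun e' => hne ?_, huI⟩ (Finset.card_lt_card ?_)
    · rw [← sub_eq_zero, ← hu, e', Finsupp.zero_apply]
    · refine (Finset.ssubset_iff_of_subset fun j hj => ?_).2
        ⟨i, Finsupp.mem_support_iff.2 hi, fun hi' => ?_⟩
      · rw [Finsupp.mem_support_iff] at hj ⊢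
        exact fun hfj => hj (by rw [hu, hg0 j hfj, zero_mul, mul_zero, sub_zero])
      · rw [Finsupp.mem_support_iff, hu, hgi, hb, hb', sub_self] at hi'
        exact hi' rfl
  choose k hk using hcomm
  refine ⟨∑ j ∈ g.support, k j • β j, fun h0 => ?_, ?_⟩
  · have hki : k i ≠ 0 := fun h0 => he.ne_zero (by rw [← hgi, hk, h0, zero_smul])
    refine hki (linearIndependent_iff'.1 β.linearIndependent _ _ h0 i ?_)
    rw [Finsupp.mem_support_iff, hgi]
    exact he.ne_zero
  · convert hg using 1
    rw [scalarCombination_apply, Finsupp.sum, Finset.sum_smul]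
    refine Finset.sum_congr rfl fun j _ => ?_
    rw [hk j, h.map_smul, Algebra.smul_def, smul_smul, mul_comm]

omit [IsScalarTower K A A] [SMulCommClass K A A] in
theorem isSimpleRing_extension (h : IsScalarExtension β ι) (hA : IsSimpleRing A) {e : A}
    (he : IsCentralCorner K e) : IsSimpleRing B := by
  have hA' := isSimpleRing_iff_nontrivial_and_forall_mem.1 hA
  rw [isSimpleRing_iff_nontrivial_and_forall_mem]
  refine ⟨h.nontrivial_iff.2 hA'.1, fun I x hx hx0 y => ?_⟩
  obtain ⟨l, hl, hlI⟩ := h.exists_smul_mem hA he I hx hx0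
  -- All multiples by `L` are demanded because `I` is only a ring ideal. That `e` qualifies follows
  -- from `(ml⁻¹e)(le) = me`.
  let N : TwoSidedIdeal A := TwoSidedIdeal.mk' {a | ∀ l : L, l • ι a ∈ I}
    (by simp [I.zero_mem])
    (fun {a b} ha hb l => by rw [map_add, smul_add]; exact I.add_mem (ha l) (hb l))
    (fun {a} ha l => by rw [map_neg, smul_neg]; exact I.neg_mem (ha l))
    (fun {a b} hb l => by rw [map_mul, ← mul_smul_comm]; exact I.mul_mem_left _ _ (hb l))
    (fun {a b} ha l => by rw [map_mul, ← smul_mul_assoc]; exact I.mul_mem_right _ _ (ha l))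
  have heN : e ∈ N := (TwoSidedIdeal.mem_mk' _ _ _ _ _ _ _).2 fun m => by
    have := I.mul_mem_left ((m * l⁻¹) • ι e) _ hlI
    rwa [smul_mul_assoc, mul_smul_comm, ← map_mul, he.mul_self, smul_smul, mul_assoc,
      inv_mul_cancel₀ hl, mul_one] at this
  have hN : ∀ (l : L) (a : A), l • ι a ∈ I := fun l a =>
    (TwoSidedIdeal.mem_mk' _ _ _ _ _ _ _).1 (hA'.2 N e heN he.ne_zero a) l
  obtain ⟨f, rfl⟩ := h.surjective y
  rw [scalarCombination_apply]
  exact sum_mem fun j _ => hN _ _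

/-- Simplicity is invariant under extension of scalars for algebras which have a central corner
as soon as they are simple. -/
theorem isSimpleRing_iff (h : IsScalarExtension β ι)
    (hA : IsSimpleRing A → ∃ e : A, IsCentralCorner K e) : IsSimpleRing B ↔ IsSimpleRing A :=
  ⟨h.isSimpleRing_of_extension, fun hs => h.isSimpleRing_extension hs (hA hs).choose_spec⟩

end IsScalarExtension

end ScalarExtension

/-! ### Fields of equal characteristic. -/

/-- If two statements about fields `K` and `L` of the same characteristic descend to the same
statement about common subfields, they are equivalent. -/
theorem iff_of_ringChar_eq {K L : Type*} [Field K] [Field L] (h : ringChar K = ringChar L)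
    {P Q : Prop} (P₀ : ∀ (F : Type) [Field F], Prop)
    (hK : ∀ (F : Type) [Field F] [Algebra F K], P ↔ P₀ F)
    (hL : ∀ (F : Type) [Field F] [Algebra F L], Q ↔ P₀ F) : P ↔ Q := by
  have cK : CharP K (ringChar K) := ringChar.charP K
  have cL : CharP L (ringChar K) := h ▸ ringChar.charP L
  -- The common subfield is `ZMod p` or `ℚ`. Both live in `Type`, whatever the universes of `K` and
  -- `L`.
  rcases CharP.char_is_prime_or_zero K (ringChar K) with hp | hp
  · have : Fact (ringChar K).Prime := ⟨hp⟩
    let _ := ZMod.algebra K (ringChar K)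
    let _ := ZMod.algebra L (ringChar K)
    exact (hK (ZMod (ringChar K))).trans (hL (ZMod (ringChar K))).symm
  · rw [hp] at cK cL
    have := CharP.charP_to_charZero K
    have := CharP.charP_to_charZero L
    exact (hK ℚ).trans (hL ℚ).symm

/-! ### Ample groupoids: compact open sets of units. -/

namespace ArrowGroupoid

section UnitBisections

variable {G : Type*} [ArrowGroupoid G]

theorem dom_eq_self_of_mem_unitSpace {g : G} (h : g ∈ unitSpace G) : dom g = g := by
  obtain ⟨x, rfl⟩ := h
  exact dom_dom x

theorem rng_eq_self_of_mem_unitSpace {g : G} (h : g ∈ unitSpace G) : rng g = g := by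
  obtain ⟨x, rfl⟩ := h
  exact rng_dom x

theorem setProd_of_subset_unitSpace {U V : Set G} (hU : U ⊆ unitSpace G)
    (hV : V ⊆ unitSpace G) : setProd U V = U ∩ V := by
  ext k
  constructor
  · rintro ⟨g, hg, h, hh, e, rfl⟩
    have e' : g = h := by
      rwa [dom_eq_self_of_mem_unitSpace (hU hg), rng_eq_self_of_mem_unitSpace (hV hh)] at e
    subst e'
    rw [comp_congr rfl (dom_eq_self_of_mem_unitSpace (hU hg)).symm e, comp_dom]
    exact ⟨hg, hh⟩
  · rintro ⟨hg, hh⟩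
    have e : dom k = rng k := by
      rw [dom_eq_self_of_mem_unitSpace (hU hg), rng_eq_self_of_mem_unitSpace (hU hg)]
    exact ⟨k, hg, k, hh, e,
      by rw [comp_congr rfl (dom_eq_self_of_mem_unitSpace (hU hg)).symm e, comp_dom]⟩

variable [TopologicalSpace G] [IsAmple G]

/-- Near a unit, `g` and `dom g` lie in one set on which the domain map is injective. They have the
same domain, so `g = dom g`. -/
theorem isOpen_unitSpace : IsOpen (unitSpace G) := by
  rw [isOpen_iff_mem_nhds]
  intro x hx
  obtain ⟨φ, hxφ, hφ⟩ := IsAmple.isLocalHomeomorph_domU (G := G) x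
  have hopen : IsOpen (φ.source ∩ dom ⁻¹' φ.source) :=
    φ.open_source.inter (φ.open_source.preimage IsAmple.continuous_dom)
  refine Filter.mem_of_superset (hopen.mem_nhds
    ⟨hxφ, by rwa [Set.mem_preimage, dom_eq_self_of_mem_unitSpace hx]⟩) ?_
  rintro g ⟨hg, hg'⟩
  refine ⟨g, φ.injOn hg' hg ?_⟩
  rw [← hφ]
  exact domU_eq.2 (dom_dom g)

/-- The compact open sets of units are local bisections, and form a basis of the unit space. -/
theorem exists_unit_bisection {W : Set G} {x : G} (hx : x ∈ unitSpace G)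
    (hW : IsOpen W) (hxW : x ∈ W) :
    ∃ U, IsCompactLocalBisection U ∧ U ⊆ unitSpace G ∧ U ⊆ W ∧ x ∈ U := by
  obtain ⟨V, ⟨hVc, hVo⟩, hxV, hVW⟩ := (IsAmple.basis (G := G)).exists_subset_of_mem_open
    (a := ⟨x, hx⟩) (u := Subtype.val ⁻¹' W) hxW (hW.preimage continuous_subtype_val)
  have hsub : Subtype.val '' V ⊆ unitSpace G := by rintro _ ⟨y, _, rfl⟩; exact y.2
  refine ⟨Subtype.val '' V, .of_injOn (hVc.image continuous_subtype_val)
    (isOpen_unitSpace.isOpenMap_subtype_val _ hVo) ?_ ?_, hsub, ?_, ⟨x, hx⟩, hxV, rfl⟩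
  · intro a ha b hb h
    rwa [dom_eq_self_of_mem_unitSpace (hsub ha), dom_eq_self_of_mem_unitSpace (hsub hb)] at h
  · intro a ha b hb h
    rwa [rng_eq_self_of_mem_unitSpace (hsub ha), rng_eq_self_of_mem_unitSpace (hsub hb)] at h
  · rintro _ ⟨y, hy, rfl⟩
    exact hVW hy

/-- Distinct units are separated by an open set of units. -/
theorem exists_isOpen_separating {x y : G} (hx : x ∈ unitSpace G) (hy : y ∈ unitSpace G)
    (hxy : y ≠ x) : ∃ W : Set G, IsOpen W ∧ y ∈ W ∧ x ∉ W := by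
  have := IsAmple.t2 (G := G)
  refine ⟨Subtype.val '' ({⟨x, hx⟩}ᶜ : Set (unitSpace G)),
    isOpen_unitSpace.isOpenMap_subtype_val _ isOpen_compl_singleton, ⟨⟨y, hy⟩, ?_, rfl⟩, ?_⟩
  · exact fun h => hxy (congrArg Subtype.val h)
  · rintro ⟨z, hz, e⟩
    exact hz (Subtype.ext e)

end UnitBisections

namespace SteinbergAlgebra

variable {K G : Type*} [CommRing K] [TopologicalSpace G] [ArrowGroupoid G]

/-- The characteristic function of a compact local bisection. -/
noncomputable def char (K : Type*) [CommRing K] (U : Set G) (hU : IsCompactLocalBisection U) :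
    SteinbergAlgebra K G :=
  ⟨U.indicator 1, indicator_mem hU⟩

theorem induction_on {p : SteinbergAlgebra K G → Prop} (f : SteinbergAlgebra K G)
    (char : ∀ U hU, p (char K U hU)) (zero : p 0) (add : ∀ f g, p f → p g → p (f + g))
    (smul : ∀ (c : K) f, p f → p (c • f)) : p f := by
  obtain ⟨f, hf⟩ := f
  induction hf using Submodule.span_induction with
  | mem f hf =>
    obtain ⟨U, hU, rfl⟩ := hf
    exact char U hU
  | zero => exact zero
  | add f g hf hg ihf ihg => exact add ⟨f, hf⟩ ⟨g, hg⟩ ihf ihg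
  | smul c f hf ihf => exact smul c ⟨f, hf⟩ ihf

theorem char_mul_char [IsAmple G] {U V : Set G} (hU : IsCompactLocalBisection U)
    (hV : IsCompactLocalBisection V) :
    char K U hU * char K V hV = char K (setProd U V) (hU.setProd hV) :=
  Subtype.ext (conv_indicator hU hV)

theorem char_mul_char_of_subset [IsAmple G] {U V : Set G} (hU : IsCompactLocalBisection U)
    (hV : IsCompactLocalBisection V) (hV' : V ⊆ unitSpace G) (hUV : U ⊆ V) :
    char K U hU * char K V hV = char K U hU ∧ char K V hV * char K U hU = char K U hU := by
  rw [char_mul_char, char_mul_char]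
  constructor
  · refine Subtype.ext (congrArg (fun W : Set G => W.indicator (1 : G → K)) ?_)
    rw [setProd_of_subset_unitSpace (hUV.trans hV') hV', Set.inter_eq_left.2 hUV]
  · refine Subtype.ext (congrArg (fun W : Set G => W.indicator (1 : G → K)) ?_)
    rw [setProd_of_subset_unitSpace hV' (hUV.trans hV'), Set.inter_eq_right.2 hUV]

/-! ### The Steinberg algebra acting on the span of the units. -/

section Representation

theorem finite_support_single (f : SteinbergAlgebra K G) (x : G) :
    (Function.support fun g : {g : G // dom g = x} =>
      Finsupp.single (rng g.1) (f.1 g.1)).Finite := by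
  refine Set.Finite.of_finite_image ((finite_fiber f.2 x).subset ?_) Subtype.val_injective.injOn
  rintro _ ⟨g, hg, rfl⟩
  exact ⟨g.2, fun h => hg (by change Finsupp.single _ _ = _; rw [h, Finsupp.single_zero])⟩

/-- The vector `f · δₓ = ∑_{dom g = x} f(g) δ_{rng g}`. -/
noncomputable def unitAct (x : G) : SteinbergAlgebra K G →ₗ[K] (G →₀ K) where
  toFun f := ∑ᶠ g : {g : G // dom g = x}, Finsupp.single (rng g.1) (f.1 g.1)
  map_add' f g := by
    rw [← finsum_add_distrib (finite_support_single f x) (finite_support_single g x)]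
    exact finsum_congr fun a => Finsupp.single_add _ _ _
  map_smul' c f := by
    rw [RingHom.id_apply, smul_finsum' c (finite_support_single f x)]
    exact finsum_congr fun a => (Finsupp.smul_single c (rng a.1) (f.1 a.1)).symm

/-- A bisection has at most one arrow over each unit, so its characteristic function acts as a
partial permutation of the basis. -/
theorem unitAct_char_of_mem {U : Set G} (hU : IsCompactLocalBisection U) {g : G} (hg : g ∈ U) :
    unitAct (dom g) (char K U hU) = Finsupp.single (rng g) 1 := by
  change (∑ᶠ a : {a : G // dom a = dom g}, Finsupp.single (rng a.1) (U.indicator 1 a.1)) = _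
  rw [finsum_eq_single _ ⟨g, rfl⟩]
  · simp [hg]
  · rintro ⟨a, ha⟩ hne
    rw [Set.indicator_of_notMem, Finsupp.single_zero]
    exact fun haU => hne (Subtype.ext (hU.eq_of_dom haU hg ha))

theorem unitAct_char_of_forall {U : Set G} (hU : IsCompactLocalBisection U) {x : G}
    (hx : ∀ g ∈ U, dom g ≠ x) : unitAct x (char K U hU) = 0 := by
  refine finsum_eq_zero_of_forall_eq_zero fun g => ?_
  change Finsupp.single (rng g.1) (U.indicator 1 g.1) = (0 : G →₀ K)
  rw [Set.indicator_of_notMem fun h => hx g.1 h g.2, Finsupp.single_zero]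

/-- The representation of the Steinberg algebra on the space spanned by the units (extended by zero
to the other arrows). -/
noncomputable def unitRep (K G : Type*) [CommRing K] [TopologicalSpace G] [ArrowGroupoid G] :
    SteinbergAlgebra K G →ₗ[K] Module.End K (G →₀ K) where
  toFun f := Finsupp.linearCombination K fun x => unitAct x f
  map_add' f g := Finsupp.lhom_ext' fun x => LinearMap.ext_ring (by simp)
  map_smul' c f := Finsupp.lhom_ext' fun x => LinearMap.ext_ring (by simp)

theorem unitRep_single (f : SteinbergAlgebra K G) (x : G) :
    unitRep K G f (Finsupp.single x 1) = unitAct x f := by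
  change Finsupp.linearCombination K (fun x => unitAct x f) (Finsupp.single x 1) = _
  rw [Finsupp.linearCombination_single, one_smul]

/-- By bilinearity it suffices to treat characteristic functions, where products of bisections
become composites of partial permutations. -/
theorem unitRep_mul [IsAmple G] (f g : SteinbergAlgebra K G) :
    unitRep K G (f * g) = unitRep K G f * unitRep K G g := by
  induction f using induction_on with
  | char U hU =>
    induction g using induction_on with
    | char V hV =>
      refine Finsupp.lhom_ext' fun x => LinearMap.ext_ring ?_
      rw [LinearMap.comp_apply, LinearMap.comp_apply, Finsupp.lsingle_apply, Module.End.mul_apply,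
        char_mul_char, unitRep_single, unitRep_single]
      by_cases hV' : ∃ h ∈ V, dom h = x
      · obtain ⟨h, hh, rfl⟩ := hV'
        rw [unitAct_char_of_mem hV hh, unitRep_single]
        by_cases hU' : ∃ g ∈ U, dom g = rng h
        · obtain ⟨g, hg, e⟩ := hU'
          have hgh : comp g h e ∈ setProd U V := ⟨g, hg, h, hh, e, rfl⟩
          have := unitAct_char_of_mem (K := K) (hU.setProd hV) hgh
          rw [dom_comp, rng_comp] at this
          rw [this, ← e, unitAct_char_of_mem hU hg]
        · rw [unitAct_char_of_forall hU fun g hg e => hU' ⟨g, hg, e⟩, unitAct_char_of_forall]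
          rintro _ ⟨a, ha, b, hb, H⟩ e
          obtain rfl := hV.eq_of_dom hb hh (H.dom_eq.symm.trans e)
          exact hU' ⟨a, ha, H.1⟩
      · rw [unitAct_char_of_forall hV fun g hg e => hV' ⟨g, hg, e⟩, map_zero,
          unitAct_char_of_forall]
        rintro _ ⟨a, ha, b, hb, H⟩ e
        exact hV' ⟨b, hb, H.dom_eq.symm.trans e⟩
    | zero => rw [mul_zero, map_zero, mul_zero]
    | add g g' h h' => rw [mul_add, map_add, map_add, h, h', mul_add]
    | smul r g h => rw [mul_smul_comm, map_smul, map_smul, h, mul_smul_comm]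
  | zero => rw [zero_mul, map_zero, zero_mul]
  | add f f' h h' => rw [add_mul, map_add, map_add, h, h', add_mul]
  | smul r f h => rw [smul_mul_assoc, map_smul, map_smul, h, smul_mul_assoc]

open Classical in
theorem unitRep_char_apply {U : Set G} (hU : IsCompactLocalBisection U)
    (hU' : U ⊆ unitSpace G) (p : G →₀ K) (y : G) :
    unitRep K G (char K U hU) p y = if y ∈ U then p y else 0 := by
  induction p using Finsupp.induction_linear with
  | zero => simp
  | add p q hp hq =>
    rw [map_add, Finsupp.add_apply, Finsupp.add_apply, hp, hq]
    split_ifs <;> simp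
  | single t k =>
    rw [← mul_one k, ← smul_eq_mul, ← Finsupp.smul_single, map_smul, unitRep_single,
      Finsupp.smul_apply, Finsupp.smul_apply]
    by_cases ht : t ∈ U
    · have := unitAct_char_of_mem (K := K) hU ht
      rw [dom_eq_self_of_mem_unitSpace (hU' ht), rng_eq_self_of_mem_unitSpace (hU' ht)] at this
      rw [this]
      by_cases hy : y = t
      · subst hy; rw [if_pos ht]
      · simp [Finsupp.single_eq_of_ne hy]
    · rw [unitAct_char_of_forall hU]
      · by_cases hy : y = t
        · subst hy; simp [if_neg ht]
        · simp [Finsupp.single_eq_of_ne hy]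
      · rintro g hg rfl
        rw [dom_eq_self_of_mem_unitSpace (hU' hg)] at ht
        exact ht hg

end Representation

theorem exists_isCentralCorner {K G : Type*} [Field K] [TopologicalSpace G] [ArrowGroupoid G]
    [IsAmple G] (hA : IsSimpleRing (SteinbergAlgebra K G)) :
    ∃ e : SteinbergAlgebra K G, IsCentralCorner K e := by
  have hnt := (isSimpleRing_iff_nontrivial_and_forall_mem.1 hA).1
  obtain ⟨f, hf⟩ := exists_ne (0 : SteinbergAlgebra K G)
  -- Nontriviality is used here only to produce an arrow, and hence a unit `x`.
  obtain ⟨g, -⟩ : ∃ g, f.1 g ≠ 0 := by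
    by_contra! h
    exact hf (Subtype.ext (funext h))
  have hx : dom g ∈ unitSpace G := ⟨g, rfl⟩
  generalize dom g = x at hx
  obtain ⟨U, hU, hU', -, hxU⟩ := exists_unit_bisection hx isOpen_univ (Set.mem_univ x)
  refine ⟨char K U hU, isCentralCorner_of_separating hA (unitRep K G) unitRep_mul
    (char_mul_char_of_subset hU hU hU' subset_rfl).1 x ?_ fun y hy => ?_⟩
  · refine Finsupp.ext fun y => ?_
    rw [unitRep_char_apply hU hU']
    split_ifs with h
    · rfl
    · exact (Finsupp.single_eq_of_ne (by rintro rfl; exact h hxU)).symm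
  · by_cases hyU : y ∈ U
    · obtain ⟨W, hW, hyW, hxW⟩ := exists_isOpen_separating hx (hU' hyU) hy
      obtain ⟨V, hV, hV', hVW, hyV⟩ :=
        exists_unit_bisection (hU' hyU) (hU.isOpen.inter hW) ⟨hyU, hyW⟩
      obtain ⟨h1, h2⟩ := char_mul_char_of_subset (K := K) hV hU hU' fun z hz => (hVW hz).1
      refine Or.inr ⟨char K V hV, h2, h1, Finsupp.ext fun z => ?_, fun p => ?_⟩
      · rw [unitRep_char_apply hV hV']
        split_ifs with h
        · exact Finsupp.single_eq_of_ne (by rintro rfl; exact hxW (hVW h).2)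
        · rfl
      · rw [unitRep_char_apply hV hV', if_pos hyV]
    · exact Or.inl fun p => by rw [unitRep_char_apply hU hU', if_neg hyU]

/-! ### Scalar extension of Steinberg algebras. -/

section Extension

variable (K L G : Type*) [Field K] [Field L] [Algebra K L] [TopologicalSpace G] [ArrowGroupoid G]

variable {K G} in
theorem algebraMap_comp_mem {f : G → K} (hf : f ∈ SteinbergAlgebra K G) :
    (fun g => algebraMap K L (f g)) ∈ SteinbergAlgebra L G := by
  induction hf using Submodule.span_induction with
  | mem f hf =>
    obtain ⟨U, hU, rfl⟩ := hf
    convert indicator_mem (K := L) hU using 1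
    funext g
    by_cases hg : g ∈ U <;> simp [hg]
  | zero =>
    convert Submodule.zero_mem (SteinbergAlgebra L G) using 1
    funext g
    simp
  | add f g _ _ hf hg =>
    convert Submodule.add_mem _ hf hg using 1
    funext a
    simp
  | smul c f _ hf =>
    convert Submodule.smul_mem _ (algebraMap K L c) hf using 1
    funext a
    simp

/-- The extension of scalars `KG → LG`. -/
noncomputable def extendScalars [IsAmple G] : SteinbergAlgebra K G →ₙ+* SteinbergAlgebra L G where
  toFun f := ⟨fun g => algebraMap K L (f.1 g), algebraMap_comp_mem L f.2⟩
  map_zero' := Subtype.ext (funext fun _ => map_zero _)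
  map_add' _ _ := Subtype.ext (funext fun _ => map_add _ _ _)
  map_mul' f g := Subtype.ext (funext fun k => by
    change algebraMap K L (∑ᶠ p : {p : G × G // IsProd p.1 p.2 k}, f.1 p.1.1 * g.1 p.1.2) =
      ∑ᶠ p : {p : G × G // IsProd p.1 p.2 k},
        algebraMap K L (f.1 p.1.1) * algebraMap K L (g.1 p.1.2)
    rw [map_finsum _ (finite_support_conv f.1 g.2 k)]
    simp only [map_mul])

variable {K L G}

/-- The spanning characteristic functions take the values 0 and 1, so they come from `K`. A relation
is tested at each arrow, where linear independence of `β` applies. -/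
theorem isScalarExtension_extendScalars [IsAmple G] {J : Type*} (β : Module.Basis J K L) :
    IsScalarExtension β (extendScalars K L G) where
  map_smul k f := Subtype.ext (funext fun g => map_mul (algebraMap K L) k (f.1 g))
  span_eq_top := by
    refine top_unique fun b _ => ?_
    induction b using induction_on with
    | char U hU =>
      refine Submodule.subset_span ⟨char K U hU, Subtype.ext (funext fun g => ?_)⟩
      change algebraMap K L (U.indicator 1 g) = U.indicator 1 g
      by_cases hg : g ∈ U <;> simp [hg]
    | zero => exact zero_mem _
    | add a b ha hb => exact add_mem (ha trivial) (hb trivial)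
    | smul c a ha => exact Submodule.smul_mem _ c (ha trivial)
  injective f hf := by
    refine Finsupp.ext fun j => Subtype.ext (funext fun s => ?_)
    have h1 := congrFun (congrArg (SteinbergAlgebra L G).subtype hf) s
    rw [scalarCombination_apply, Finsupp.sum, map_sum, Finset.sum_apply] at h1
    by_cases hj : j ∈ f.support
    · refine linearIndependent_iff'.1 β.linearIndependent f.support
        (fun j => (f j).1 s) ?_ j hj
      refine Eq.trans (Finset.sum_congr rfl fun i _ => ?_) h1
      rw [Algebra.smul_def, mul_comm]
      rfl
    · rw [Finsupp.notMem_support_iff.1 hj]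
      rfl

end Extension

/-- Simplicity of the Steinberg algebra of an ample groupoid is invariant under field
extensions. -/
theorem isSimpleRing_iff_of_algebra (K L G : Type*) [Field K] [Field L] [Algebra K L]
    [TopologicalSpace G] [ArrowGroupoid G] [IsAmple G] :
    IsSimpleRing (SteinbergAlgebra L G) ↔ IsSimpleRing (SteinbergAlgebra K G) :=
  (isScalarExtension_extendScalars (Module.Basis.ofVectorSpace K L)).isSimpleRing_iff
    exists_isCentralCorner

end SteinbergAlgebra

end ArrowGroupoid

/-! ### Inverse semigroups: commuting idempotents and the involution. -/

namespace IsInverseSemigroup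

variable {S : Type*} [Semigroup S]

/-- If `a` is the inverse of `ef`, then so is `fae`, whence `a = fae`. This makes `a` idempotent and
therefore its own inverse; but `ef` is also the inverse of `a`. -/
theorem mul_idempotent (hS : IsInverseSemigroup S) {e f : S} (he : e * e = e) (hf : f * f = f) :
    (e * f) * (e * f) = e * f := by
  obtain ⟨a, ⟨h1, h2⟩, huniq⟩ := hS (e * f)
  have ha : f * a * e = a := by
    refine huniq _ ⟨?_, ?_⟩
    · calc e * f * (f * a * e) * (e * f) = e * (f * f) * a * (e * e) * f := by simp only [mul_assoc]
        _ = e * f * a * (e * f) := by rw [he, hf]; simp only [mul_assoc]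
        _ = e * f := h1
    · calc f * a * e * (e * f) * (f * a * e) = f * (a * ((e * e) * (f * f)) * a) * e := by
            simp only [mul_assoc]
        _ = f * a * e := by rw [he, hf, h2]
  have haa : a * a = a := by
    calc a * a = (f * a * e) * (f * a * e) := by rw [ha]
      _ = f * (a * (e * f) * a) * e := by simp only [mul_assoc]
      _ = a := by rw [h2, ha]
  have : e * f = a :=
    (hS a).unique ⟨h2, h1⟩ ⟨by rw [haa, haa], by rw [haa, haa]⟩
  rw [this, haa]

/-- Since `ef` and `fe` are idempotent, both are inverses of `ef`. -/
theorem idempotent_comm (hS : IsInverseSemigroup S) {e f : S} (he : e * e = e)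
    (hf : f * f = f) : e * f = f * e := by
  have h1 := hS.mul_idempotent he hf
  have h2 := hS.mul_idempotent hf he
  refine (hS (e * f)).unique ⟨by rw [h1, h1], by rw [h1, h1]⟩ ⟨?_, ?_⟩
  · calc e * f * (f * e) * (e * f) = e * (f * f) * (e * e) * f := by simp only [mul_assoc]
      _ = e * f * (e * f) := by rw [he, hf]; simp only [mul_assoc]
      _ = e * f := h1
  · calc f * e * (e * f) * (f * e) = f * (e * e) * (f * f) * e := by simp only [mul_assoc]
      _ = f * e * (f * e) := by rw [he, hf]; simp only [mul_assoc]
      _ = f * e := h2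

/-- The inverse of an element of an inverse semigroup. -/
noncomputable def star (hS : IsInverseSemigroup S) (s : S) : S := (hS s).choose

theorem mul_star_mul (hS : IsInverseSemigroup S) (s : S) : s * hS.star s * s = s :=
  (hS s).choose_spec.1.1

theorem star_mul_star (hS : IsInverseSemigroup S) (s : S) :
    hS.star s * s * hS.star s = hS.star s :=
  (hS s).choose_spec.1.2

theorem star_eq (hS : IsInverseSemigroup S) {s t : S} (h1 : s * t * s = s) (h2 : t * s * t = t) :
    hS.star s = t :=
  ((hS s).choose_spec.2 t ⟨h1, h2⟩).symm

theorem star_mul_self_idem (hS : IsInverseSemigroup S) (s : S) :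
    (hS.star s * s) * (hS.star s * s) = hS.star s * s := by
  rw [← mul_assoc, hS.star_mul_star]

theorem mul_star_self_idem (hS : IsInverseSemigroup S) (s : S) :
    (s * hS.star s) * (s * hS.star s) = s * hS.star s := by
  rw [← mul_assoc, hS.mul_star_mul]

theorem star_mul (hS : IsInverseSemigroup S) (s t : S) :
    hS.star (s * t) = hS.star t * hS.star s := by
  have hc := hS.idempotent_comm (hS.mul_star_self_idem t) (hS.star_mul_self_idem s)
  refine hS.star_eq ?_ ?_
  · calc s * t * (hS.star t * hS.star s) * (s * t)
        = s * ((t * hS.star t) * (hS.star s * s)) * t := by simp only [mul_assoc]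
      _ = (s * hS.star s * s) * (t * hS.star t * t) := by rw [hc]; simp only [mul_assoc]
      _ = s * t := by rw [hS.mul_star_mul, hS.mul_star_mul]
  · calc hS.star t * hS.star s * (s * t) * (hS.star t * hS.star s)
        = hS.star t * ((hS.star s * s) * (t * hS.star t)) * hS.star s := by simp only [mul_assoc]
      _ = (hS.star t * t * hS.star t) * (hS.star s * s * hS.star s) := by
          rw [← hc]; simp only [mul_assoc]
      _ = hS.star t * hS.star s := by rw [hS.star_mul_star, hS.star_mul_star]

theorem star_of_idem (hS : IsInverseSemigroup S) {e : S} (he : e * e = e) : hS.star e = e :=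
  hS.star_eq (by rw [he, he]) (by rw [he, he])

end IsInverseSemigroup

/-! ### The Munn representation on the nonzero idempotents. -/

namespace ContractedAlgebra

section Munn

variable {S : Type*} [SemigroupWithZero S] (hS : IsInverseSemigroup S)

/-- `t` is a nonzero idempotent lying below `s⋆s`. -/
def MunnDomain (s t : S) : Prop := t ≠ 0 ∧ t * t = t ∧ hS.star s * s * t = t

theorem MunnDomain.conj_idem {s t : S} (h : MunnDomain hS s t) :
    (s * t * hS.star s) * (s * t * hS.star s) = s * t * hS.star s := by
  calc (s * t * hS.star s) * (s * t * hS.star s)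
      = s * t * (hS.star s * s * t) * hS.star s := by simp only [mul_assoc]
    _ = s * t * hS.star s := by rw [h.2.2, mul_assoc s, h.2.1]

theorem MunnDomain.conj_ne_zero {s t : S} (h : MunnDomain hS s t) : s * t * hS.star s ≠ 0 := by
  intro h0
  refine h.1 ?_
  calc t = (hS.star s * s * t) * (hS.star s * s * t) := by rw [h.2.2, h.2.1]
    _ = hS.star s * (s * t * hS.star s) * (s * t) := by simp only [mul_assoc]
    _ = 0 := by rw [h0, mul_zero, zero_mul]

/-- This makes the partial maps `t ↦ s t s⋆` compose exactly, domains included. Commuting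
idempotents drive it: `s⋆s` with `uu⋆` in one direction, `t` with `u⋆u` in the other. -/
theorem munnDomain_mul {s u t : S} :
    MunnDomain hS (s * u) t ↔ MunnDomain hS u t ∧ MunnDomain hS s (u * t * hS.star u) := by
  have hc := hS.idempotent_comm (hS.star_mul_self_idem s) (hS.mul_star_self_idem u)
  constructor
  · rintro ⟨h0, hi, h⟩
    rw [hS.star_mul] at h
    have h1 : hS.star u * u * t = t := by
      calc hS.star u * u * t
          = (hS.star u * u * hS.star u) * (hS.star s * (s * u) * t) := by
            conv_lhs => rw [← h]
            simp only [mul_assoc]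
        _ = t := by rw [hS.star_mul_star]; simpa only [mul_assoc] using h
    have hu : MunnDomain hS u t := ⟨h0, hi, h1⟩
    refine ⟨hu, hu.conj_ne_zero, hu.conj_idem, ?_⟩
    -- Writing `u` as `uu⋆u` creates the idempotent `uu⋆`, which `s⋆s` can cross.
    calc hS.star s * s * (u * t * hS.star u)
        = hS.star s * s * (u * hS.star u * u) * t * hS.star u := by
          rw [hS.mul_star_mul]; simp only [mul_assoc]
      _ = (hS.star s * s) * (u * hS.star u) * u * t * hS.star u := by simp only [mul_assoc]
      _ = u * (hS.star u * hS.star s * (s * u) * t) * hS.star u := by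
          rw [hc]; simp only [mul_assoc]
      _ = u * t * hS.star u := by rw [h]
  · rintro ⟨⟨h0, hi, h1⟩, -, -, h2⟩
    have h3 : t * (hS.star u * u) = t := by
      rw [hS.idempotent_comm hi (hS.star_mul_self_idem u), h1]
    refine ⟨h0, hi, ?_⟩
    rw [hS.star_mul]
    calc hS.star u * hS.star s * (s * u) * t
        = hS.star u * hS.star s * (s * u) * (t * (hS.star u * u)) := by rw [h3]
      _ = hS.star u * (hS.star s * s * (u * t * hS.star u)) * u := by simp only [mul_assoc]
      _ = (hS.star u * u * t) * (hS.star u * u) := by rw [h2]; simp only [mul_assoc]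
      _ = t := by rw [h1, h3]

open Classical in
/-- The Munn action of `s` on the span of the nonzero idempotents: `t ↦ s t s⋆` if `t ≤ s⋆s`,
and `t ↦ 0` otherwise. -/
noncomputable def munnMap (K : Type*) [Field K] (s : S) : Module.End K (S →₀ K) :=
  Finsupp.linearCombination K fun t =>
    if MunnDomain hS s t then Finsupp.single (s * t * hS.star s) (1 : K) else 0

open Classical in
theorem munnMap_single (K : Type*) [Field K] (s t : S) :
    munnMap hS K s (Finsupp.single t 1) =
      if MunnDomain hS s t then Finsupp.single (s * t * hS.star s) (1 : K) else 0 := by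
  rw [munnMap, Finsupp.linearCombination_single, one_smul]

theorem munnMap_mul (K : Type*) [Field K] (s u : S) :
    munnMap hS K (s * u) = munnMap hS K s * munnMap hS K u := by
  classical
  refine Finsupp.lhom_ext' fun t => LinearMap.ext_ring ?_
  simp only [LinearMap.comp_apply, Finsupp.lsingle_apply, Module.End.mul_apply, munnMap_single]
  by_cases hu : MunnDomain hS u t
  · rw [if_pos hu, munnMap_single]
    by_cases hs : MunnDomain hS s (u * t * hS.star u)
    · rw [if_pos ((munnDomain_mul hS).2 ⟨hu, hs⟩), if_pos hs, hS.star_mul]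
      simp only [mul_assoc]
    · rw [if_neg fun h => hs ((munnDomain_mul hS).1 h).2, if_neg hs]
  · rw [if_neg fun h => hu ((munnDomain_mul hS).1 h).1, if_neg hu, map_zero]

theorem munnMap_zero (K : Type*) [Field K] : munnMap hS K 0 = 0 := by
  refine Finsupp.lhom_ext' fun t => LinearMap.ext_ring ?_
  rw [LinearMap.comp_apply, Finsupp.lsingle_apply, munnMap_single, if_neg]
  · rfl
  · rintro ⟨h0, -, h⟩
    exact h0 (by rw [← h, mul_zero, zero_mul])

open Classical in
theorem munnMap_idem_apply (K : Type*) [Field K] {f : S} (hf : f * f = f) (p : S →₀ K) (y : S) :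
    munnMap hS K f p y = if y ≠ 0 ∧ y * y = y ∧ f * y = y then p y else 0 := by
  induction p using Finsupp.induction_linear with
  | zero => simp
  | add p q hp hq =>
    rw [map_add, Finsupp.add_apply, Finsupp.add_apply, hp, hq]
    split_ifs <;> simp
  | single t k =>
    rw [← mul_one k, ← smul_eq_mul, ← Finsupp.smul_single, map_smul, munnMap_single,
      Finsupp.smul_apply, Finsupp.smul_apply, MunnDomain, hS.star_of_idem hf, hf]
    by_cases ht : t ≠ 0 ∧ t * t = t ∧ f * t = t
    · have : f * t * f = t := by rw [ht.2.2, hS.idempotent_comm ht.2.1 hf, ht.2.2]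
      rw [if_pos ht, this]
      by_cases hy : y = t
      · subst hy; rw [if_pos ht]
      · simp [Finsupp.single_eq_of_ne hy]
    · rw [if_neg ht]
      by_cases hy : y = t
      · subst hy; simp [if_neg ht]
      · simp [Finsupp.single_eq_of_ne hy]

/-- The Munn representation of the contracted algebra. -/
noncomputable def munnRep (K : Type*) [Field K] :
    ContractedAlgebra K S →ₗ[K] Module.End K (S →₀ K) :=
  (basis K S).constr K fun s => munnMap hS K s.1

theorem munnRep_of (K : Type*) [Field K] (s : S) : munnRep hS K (of K S s) = munnMap hS K s := by
  by_cases hs : s = 0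
  · rw [hs, of_zero, map_zero, munnMap_zero]
  · have := of_coe K S ⟨s, hs⟩
    simp only at this
    rw [this, munnRep, Module.Basis.constr_basis]

theorem of_mul_of (K : Type*) [Field K] (s t : S) : of K S s * of K S t = of K S (s * t) :=
  mulMap_of K S s t

theorem munnRep_mul (K : Type*) [Field K] (a b : ContractedAlgebra K S) :
    munnRep hS K (a * b) = munnRep hS K a * munnRep hS K b := by
  induction a using induction_on with
  | of s =>
    induction b using induction_on with
    | of t => rw [of_mul_of, munnRep_of, munnRep_of, munnRep_of, munnMap_mul]
    | add b b' h h' => rw [mul_add, map_add, map_add, h, h', mul_add]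
    | smul r b h => rw [mul_smul_comm, map_smul, map_smul, h, mul_smul_comm]
  | add a a' h h' => rw [add_mul, map_add, map_add, h, h', add_mul]
  | smul r a h => rw [smul_mul_assoc, map_smul, map_smul, h, smul_mul_assoc]

end Munn

theorem exists_isCentralCorner {K S : Type*} [Field K] [SemigroupWithZero S]
    (hS : IsInverseSemigroup S) (hA : IsSimpleRing (ContractedAlgebra K S)) :
    ∃ e : ContractedAlgebra K S, IsCentralCorner K e := by
  have hnt := (isSimpleRing_iff_nontrivial_and_forall_mem.1 hA).1
  obtain ⟨s, hs⟩ : ∃ s : S, s ≠ 0 := by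
    by_contra! h
    obtain ⟨a, ha⟩ := exists_ne (0 : ContractedAlgebra K S)
    exact ha (Finsupp.ext fun s => absurd (h s.1) s.2)
  obtain ⟨e, he0, he⟩ : ∃ e : S, e ≠ 0 ∧ e * e = e :=
    ⟨hS.star s * s, fun h => hs (by rw [← hS.mul_star_mul s, mul_assoc, h, mul_zero]),
      hS.star_mul_self_idem s⟩
  refine ⟨of K S e, isCentralCorner_of_separating hA (munnRep hS K) (munnRep_mul hS K)
    (by rw [of_mul_of, he]) e ?_ fun y hy => ?_⟩
  · rw [munnRep_of, munnMap_single, MunnDomain, hS.star_of_idem he, he, he, if_pos ⟨he0, rfl, rfl⟩]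
  · by_cases h : y ≠ 0 ∧ y * y = y ∧ e * y = y
    · have hye : y * e = y := by rw [← hS.idempotent_comm he h.2.1, h.2.2]
      refine Or.inr ⟨of K S y, by rw [of_mul_of, h.2.2], by rw [of_mul_of, hye], ?_, fun p => ?_⟩
      · rw [munnRep_of, munnMap_single, MunnDomain, hS.star_of_idem h.2.1, h.2.1, hye, if_neg]
        exact fun h' => hy h'.2.2
      · rw [munnRep_of, munnMap_idem_apply hS K h.2.1, if_pos ⟨h.1, h.2.1, h.2.1⟩]
    · exact Or.inl fun p => by rw [munnRep_of, munnMap_idem_apply hS K he, if_neg h]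

/-! ### Scalar extension of contracted algebras. -/

section Extension

variable (K L S : Type*) [Field K] [Field L] [Algebra K L] [SemigroupWithZero S]

/-- The extension of scalars `K₀S → L₀S` as an additive map. -/
noncomputable def extendScalarsAddHom : ContractedAlgebra K S →+ ContractedAlgebra L S :=
  Finsupp.mapRange.addMonoidHom (algebraMap K L : K →+ L)

theorem extendScalarsAddHom_apply (a : ContractedAlgebra K S) (s : {s : S // s ≠ 0}) :
    (basis L S).repr (extendScalarsAddHom K L S a) s = algebraMap K L ((basis K S).repr a s) :=
  rfl

theorem extendScalarsAddHom_smul (k : K) (a : ContractedAlgebra K S) :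
    extendScalarsAddHom K L S (k • a) = algebraMap K L k • extendScalarsAddHom K L S a := by
  refine (basis L S).repr.injective (Finsupp.ext fun s => ?_)
  rw [extendScalarsAddHom_apply, map_smul, map_smul, Finsupp.smul_apply, Finsupp.smul_apply,
    extendScalarsAddHom_apply, smul_eq_mul, smul_eq_mul, map_mul]

theorem extendScalarsAddHom_of (s : S) : extendScalarsAddHom K L S (of K S s) = of L S s := by
  classical
  by_cases hs : s = 0
  · rw [hs, of_zero, of_zero, map_zero]
  · have h1 := of_coe K S ⟨s, hs⟩
    have h2 := of_coe L S ⟨s, hs⟩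
    simp only at h1 h2
    rw [h1, h2]
    refine (basis L S).repr.injective (Finsupp.ext fun t => ?_)
    rw [extendScalarsAddHom_apply, Module.Basis.repr_self, Module.Basis.repr_self,
      Finsupp.single_apply, Finsupp.single_apply]
    split_ifs <;> simp

/-- The extension of scalars `K₀S → L₀S`. -/
noncomputable def extendScalars : ContractedAlgebra K S →ₙ+* ContractedAlgebra L S :=
  { extendScalarsAddHom K L S with
    map_mul' := fun a b => by
      change extendScalarsAddHom K L S (a * b) =
        extendScalarsAddHom K L S a * extendScalarsAddHom K L S b
      induction a using induction_on with
      | of s =>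
        induction b using induction_on with
        | of t => simp only [of_mul_of, extendScalarsAddHom_of]
        | add b b' h h' => simp only [mul_add, map_add, h, h']
        | smul r b h => simp only [mul_smul_comm, extendScalarsAddHom_smul, h]
      | add a a' h h' => simp only [add_mul, map_add, h, h']
      | smul r a h => simp only [smul_mul_assoc, extendScalarsAddHom_smul, h] }

variable {K L S}

theorem isScalarExtension_extendScalars {J : Type*} (β : Module.Basis J K L) :
    IsScalarExtension β (extendScalars K L S) where
  map_smul := extendScalarsAddHom_smul K L S
  span_eq_top := by
    refine top_unique fun b _ => ?_
    induction b using induction_on with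
    | of s => exact Submodule.subset_span ⟨of K S s, extendScalarsAddHom_of K L S s⟩
    | add a b ha hb => exact add_mem (ha trivial) (hb trivial)
    | smul c a ha => exact Submodule.smul_mem _ c (ha trivial)
  injective f hf := by
    refine Finsupp.ext fun j => (basis K S).repr.injective (Finsupp.ext fun s => ?_)
    have h1 := DFunLike.congr_fun (congrArg (basis L S).repr hf) s
    rw [scalarCombination_apply, Finsupp.sum, map_sum, Finsupp.finsetSum_apply] at h1
    by_cases hj : j ∈ f.support
    · refine linearIndependent_iff'.1 β.linearIndependent f.support
        (fun j => (basis K S).repr (f j) s) ?_ j hj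
      refine Eq.trans (Finset.sum_congr rfl fun i _ => ?_) (h1.trans (by simp))
      rw [map_smul, Finsupp.smul_apply, smul_eq_mul, Algebra.smul_def, mul_comm]
      rfl
    · rw [Finsupp.notMem_support_iff.1 hj]
      rfl

end Extension

/-- Simplicity of the contracted algebra of an inverse semigroup is invariant under field
extensions. -/
theorem isSimpleRing_iff_of_algebra (K L : Type*) {S : Type*} [Field K] [Field L] [Algebra K L]
    [SemigroupWithZero S] (hS : IsInverseSemigroup S) :
    IsSimpleRing (ContractedAlgebra L S) ↔ IsSimpleRing (ContractedAlgebra K S) :=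
  (isScalarExtension_extendScalars (Module.Basis.ofVectorSpace K L)).isSimpleRing_iff
    (exists_isCentralCorner hS)

end ContractedAlgebra

/-! ### The theorem. -/

theorem mainTheorem7 :
    (∀ (G : Type*) [TopologicalSpace G] [ArrowGroupoid G] [ArrowGroupoid.IsAmple G],
      (∀ (L : Type*) [Field L],
        IsSimpleRing (ArrowGroupoid.SteinbergAlgebra L G) ↔
          IsSimpleRing (ArrowGroupoid.SteinbergAlgebra (⊥ : Subfield L) G)) ∧
      (∀ (K L : Type*) [Field K] [Field L], ringChar K = ringChar L →
        (IsSimpleRing (ArrowGroupoid.SteinbergAlgebra K G) ↔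
          IsSimpleRing (ArrowGroupoid.SteinbergAlgebra L G)))) ∧
    (∀ (S : Type*) [SemigroupWithZero S], IsInverseSemigroup S →
      (∀ (L : Type*) [Field L],
        IsSimpleRing (ContractedAlgebra L S) ↔
          IsSimpleRing (ContractedAlgebra (⊥ : Subfield L) S)) ∧
      (∀ (K L : Type*) [Field K] [Field L], ringChar K = ringChar L →
        (IsSimpleRing (ContractedAlgebra K S) ↔
          IsSimpleRing (ContractedAlgebra L S)))) := by
  refine ⟨fun G _ _ _ => ⟨fun L _ => ?_, fun K L _ _ h => ?_⟩,
    fun S _ hS => ⟨fun L _ => ?_, fun K L _ _ h => ?_⟩⟩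
  · exact ArrowGroupoid.SteinbergAlgebra.isSimpleRing_iff_of_algebra (⊥ : Subfield L) L G
  · exact iff_of_ringChar_eq h
      (fun F _ => IsSimpleRing (ArrowGroupoid.SteinbergAlgebra F G))
      (fun F _ _ => ArrowGroupoid.SteinbergAlgebra.isSimpleRing_iff_of_algebra F K G)
      (fun F _ _ => ArrowGroupoid.SteinbergAlgebra.isSimpleRing_iff_of_algebra F L G)
  · exact ContractedAlgebra.isSimpleRing_iff_of_algebra (⊥ : Subfield L) L hS
  · exact iff_of_ringChar_eq h (fun F _ => IsSimpleRing (ContractedAlgebra F S))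
      (fun F _ _ => ContractedAlgebra.isSimpleRing_iff_of_algebra F K hS)
      (fun F _ _ => ContractedAlgebra.isSimpleRing_iff_of_algebra F L hS)
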